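/- In this statement, a group is \emph{virtually cyclic} if it is finite or has an infinite cyclic subgroup of finite index, and a \emph{hyperbolic group} is a finitely generated group that is hyperbolic in the sense of Gromov. The \emph{$\forall\exists$-theory} $\mathrm{Th}_{\forall\exists}(G)$ of a group $G$ is the set of all first-order sentences in the language of groups of the form $\forall \boldsymbol{y}\,\exists \boldsymbol{z}\ \varphi(\boldsymbol{y},\boldsymbol{z})$, with $\varphi$ quantifier-free, that are true in $G$. For a finite subgroup $C$ of $G$, let $N_G(C)$ be its normalizer and $$\mathrm{Aut}_G(C)=\{\alpha\in\mathrm{Aut}(C)\mid \exists g\in N_G(C)\ \forall c\in C,\ \alpha(c)=gcg^{-1}\}.$$ If $G$ is hyperbolic and $K\le G$ is a subgroup that is not virtually cyclic, $E_G(K)$ denotes the unique maximal finite subgroup of $G$ normalized by $K$. For a hyperbolic group $G$, define: - $n_1(G)$, the number of conjugacy classes of finite subgroups of $G$; - $n_2(G)=\sum_{k=1}^{n_1(G)}|\mathrm{Aut}_G(C_k)|$, where $C_1,\dots,C_{n_1(G)}$ are representatives of the conjugacy classes of finite subgroups of $G$; - $n_3(G)$, the number of conjugacy classes of finite subgroups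 $C$ of $G$ such that $N_G(C)$ is infinite and virtually cyclic; - $n_4(G)$, the number of conjugacy classes of finite subgroups $C$ of $G$ such that $N_G(C)$ is not virtually cyclic; - $n_5(G)$, the number of conjugacy classes of finite subgroups $C$ of $G$ such that $N_G(C)$ is not virtually cyclic and $E_G(N_G(C))\neq C$. **Lemma.** Let $G$ and $G'$ be two hyperbolic groups with $\mathrm{Th}_{\forall\exists}(G)=\mathrm{Th}_{\forall\exists}(G')$. Then $G$ and $G'$ have only finitely many conjugacy classes of finite subgroups (so that the numbers above are well-defined integers), and $n_i(G)=n_i(G')$ for $1\le i\le 5$. -/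

import Mathlib

open scoped FirstOrder

namespace GroupInvariants

/-! ### First-order logic of groups -/

/-- The function symbols of the language of groups: multiplication, inverse and identity. -/
inductive GroupFunc : ℕ → Type
  | mul : GroupFunc 2
  | inv : GroupFunc 1
  | one : GroupFunc 0

/-- The first-order language of groups; it has no relation symbol besides equality. -/
def groupLang : FirstOrder.Language.{0, 0} where
  Functions := GroupFunc
  Relations := fun _ => Empty

/-- Every group is a structure for the language of groups, with the obvious interpretation. -/
instance groupStructure (G : Type*) [Group G] : groupLang.Structure G where
  funMap := fun {_} f =>
    match f with
    | GroupFunc.mul => fun x => x 0 * x 1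
    | GroupFunc.inv => fun x => (x 0)⁻¹
    | GroupFunc.one => fun _ => 1
  RelMap := fun {_} r => Empty.elim r

/-- `∀∃`-formulas: a (possibly empty) block of universal quantifiers, followed by a (possibly
empty) block of existential quantifiers, followed by a quantifier-free formula. -/
inductive IsForallExists {L : FirstOrder.Language.{0, 0}} {α : Type} :
    ∀ {n : ℕ}, L.BoundedFormula α n → Prop
  | of_isExistential {n : ℕ} {φ : L.BoundedFormula α n} (h : φ.IsExistential) : IsForallExists φ
  | all {n : ℕ} {φ : L.BoundedFormula α (n + 1)} (h : IsForallExists φ) : IsForallExists φ.all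

/-- The `∀∃`-theory of a group: the set of all `∀∃`-sentences that hold in it. -/
def forallExistsTheory (G : Type*) [Group G] : Set groupLang.Sentence :=
  {φ | IsForallExists φ ∧ G ⊨ φ}

/-! ### Hyperbolic and virtually cyclic groups -/

/-- A group is hyperbolic if it has a finite generating set `S` whose Cayley graph is hyperbolic in
the sense of Gromov. Hyperbolicity is expressed by the four-point condition for the word metric,
which is the graph distance on the vertices of the Cayley graph; since the vertices are `1/2`-dense
in the geometric realization, this is the same as hyperbolicity of the latter. -/
def IsHyperbolicGroup (G : Type*) [Group G] : Prop :=
  ∃ S : Set G, S.Finite ∧ Subgroup.closure S = ⊤ ∧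
    ∃ δ : ℕ, ∀ x y z w : G,
      (SimpleGraph.mulCayley S).dist x y + (SimpleGraph.mulCayley S).dist z w ≤
        max ((SimpleGraph.mulCayley S).dist x z + (SimpleGraph.mulCayley S).dist y w)
          ((SimpleGraph.mulCayley S).dist x w + (SimpleGraph.mulCayley S).dist y z) + δ

/-- A group is virtually cyclic (finite or virtually `ℤ`) if it has a cyclic subgroup of finite
index. -/
def IsVirtuallyCyclic (G : Type*) [Group G] : Prop :=
  ∃ H : Subgroup G, IsCyclic H ∧ H.FiniteIndex

/-! ### Finite subgroups up to conjugacy -/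

/-- The finite subgroups of `G`. -/
abbrev FiniteSubgroup (G : Type*) [Group G] : Type _ := {C : Subgroup G // Finite C}

/-- Conjugacy of finite subgroups of `G`: `D = g C g⁻¹` for some `g`. -/
def finiteSubgroupSetoid (G : Type*) [Group G] : Setoid (FiniteSubgroup G) where
  r C D := ∃ g : G, D.1 = C.1.map (MulAut.conj g).toMonoidHom
  iseqv := by
    refine ⟨fun C => ⟨1, ?_⟩, ?_, ?_⟩
    · ext x
      simp [Subgroup.mem_map]
    · rintro C D ⟨g, h⟩
      refine ⟨g⁻¹, ?_⟩
      rw [h, Subgroup.map_map]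
      ext x
      simp [Subgroup.mem_map, mul_assoc]
    · rintro C D E ⟨g, h⟩ ⟨k, h'⟩
      refine ⟨k * g, ?_⟩
      rw [h', h, Subgroup.map_map]
      congr 1
      ext x
      simp [mul_assoc]

/-- The type of conjugacy classes of finite subgroups of `G`. -/
def FiniteSubgroupClass (G : Type*) [Group G] : Type _ := Quotient (finiteSubgroupSetoid G)

/-- The conjugacy class of a finite subgroup. -/
def FiniteSubgroup.cls {G : Type*} [Group G] (C : FiniteSubgroup G) : FiniteSubgroupClass G :=
  Quotient.mk (finiteSubgroupSetoid G) C

/-- A representative of a conjugacy class of finite subgroups. -/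
noncomputable def FiniteSubgroupClass.rep {G : Type*} [Group G] (c : FiniteSubgroupClass G) :
    FiniteSubgroup G :=
  Quotient.out (s := finiteSubgroupSetoid G) c

/-- `Aut_G(C)`: the automorphisms of `C` that are induced by conjugation by an element of the
normalizer of `C` in `G`. -/
def autIn {G : Type*} [Group G] (C : Subgroup G) : Set (MulAut C) :=
  {α | ∃ g ∈ Subgroup.normalizer (C : Set G), ∀ c : C, (α c : G) = g * c * g⁻¹}

/-- `E_G(K)`: the largest finite subgroup of `G` normalized by `K`, written as the join of all
finite subgroups of `G` normalized by `K` (see `maxFiniteNormalized_eq`). It is used for non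
virtually cyclic subgroups `K` of hyperbolic groups `G`, for which there is a largest one. -/
def maxFiniteNormalized {G : Type*} [Group G] (K : Subgroup G) : Subgroup G :=
  sSup {F : Subgroup G | Finite F ∧ K ≤ Subgroup.normalizer (F : Set G)}

/-- If there is a largest finite subgroup normalized by `K`, then it is `E_G(K)`. -/
theorem maxFiniteNormalized_eq {G : Type*} [Group G] {K E : Subgroup G}
    (h : IsGreatest {F : Subgroup G | Finite F ∧ K ≤ Subgroup.normalizer (F : Set G)} E) :
    maxFiniteNormalized K = E :=
  h.isLUB.sSup_eq

/-! ### The five numbers -/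

/-- The number of conjugacy classes of finite subgroups of `G`. -/
noncomputable def n₁ (G : Type*) [Group G] : ℕ := Nat.card (FiniteSubgroupClass G)

/-- The sum of the orders of `Aut_G(C)`, where `C` runs through representatives of the conjugacy
classes of finite subgroups of `G`. -/
noncomputable def n₂ (G : Type*) [Group G] : ℕ :=
  ∑ᶠ c : FiniteSubgroupClass G, Nat.card (autIn c.rep.1)

/-- The number of conjugacy classes of finite subgroups `C` of `G` such that `N_G(C)` is infinite
virtually cyclic. -/
noncomputable def n₃ (G : Type*) [Group G] : ℕ :=
  Set.ncard {c : FiniteSubgroupClass G | ∃ C : FiniteSubgroup G, C.cls = c ∧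
    Infinite (Subgroup.normalizer (C.1 : Set G)) ∧
    IsVirtuallyCyclic (Subgroup.normalizer (C.1 : Set G))}

/-- The number of conjugacy classes of finite subgroups `C` of `G` such that `N_G(C)` is not
virtually cyclic. -/
noncomputable def n₄ (G : Type*) [Group G] : ℕ :=
  Set.ncard {c : FiniteSubgroupClass G | ∃ C : FiniteSubgroup G, C.cls = c ∧
    ¬ IsVirtuallyCyclic (Subgroup.normalizer (C.1 : Set G))}

/-- The number of conjugacy classes of finite subgroups `C` of `G` such that `N_G(C)` is not
virtually cyclic and `E_G(N_G(C)) ≠ C`. -/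
noncomputable def n₅ (G : Type*) [Group G] : ℕ :=
  Set.ncard {c : FiniteSubgroupClass G | ∃ C : FiniteSubgroup G, C.cls = c ∧
    ¬ IsVirtuallyCyclic (Subgroup.normalizer (C.1 : Set G)) ∧
    maxFiniteNormalized (Subgroup.normalizer (C.1 : Set G)) ≠ C.1}

end GroupInvariants

/-! Negation exchanges `∀∃`- and `∃∀`-sentences, so every `∃∀`-sentence true in one group holds in
the other, and by symmetry it suffices to prove inequalities between counts. Choose representatives
of the finitely many classes counted in `G`. A single `∃∀`-sentence provides elements realizing
their multiplication tables, distinct within each table, and says that no `g` conjugates one of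
these subgroups onto another. Its witnesses in `G'` form isomorphic, pairwise non-conjugate finite
subgroups (`exists_family_of_expresses`). The same sentence can carry further conditions on each
subgroup, as long as these are `∃∀` too.

The conditions needed become `∃∀` as follows. A lower bound on the order of `Aut_G(C)` is witnessed
by conjugating elements. In a hyperbolic group torsion subgroups have bounded order, so for a
suitable exponent `K` a subgroup is infinite iff it contains some `g` with `g ^ K ≠ 1`, and it fails
to be virtually cyclic iff it contains `g`, `h` whose `K`-th powers do not commute
(`IsHyperbolicGroup.isVirtuallyCyclic_iff`). The condition `E_G(N_G(C)) ≠ C` is witnessed by a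
finite group `F`, not inside `C`, that is normalized by every `g` normalizing `C`. Finally `n₃` is
the number of classes with infinite normalizer minus `n₄`.

The geometric input is derived from the four-point condition: torsion subgroups are conjugate into a
fixed ball (`HyperbolicMetric.exists_conj_mem_ball`), which gives both finiteness statements, and an
element of infinite order generates a finite-index subgroup of its centralizer
(`HyperbolicMetric.relIndex_zpowers_centralizer_ne_zero`). -/

namespace GroupInvariants

/-! ### Groups with a left-invariant hyperbolic metric -/

/-- A left-invariant proper integer-valued metric on a group which satisfies the four-point
condition and has enough points on geodesics. -/
structure HyperbolicMetric (G : Type*) [Group G] where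
  /-- the distance -/
  d : G → G → ℤ
  /-- the hyperbolicity constant -/
  δ : ℕ
  nonneg : ∀ x y, 0 ≤ d x y
  self : ∀ x, d x x = 0
  comm : ∀ x y, d x y = d y x
  triangle : ∀ x y z, d x z ≤ d x y + d y z
  mul_left : ∀ g x y, d (g * x) (g * y) = d x y
  fourPoint : ∀ x y z w, d x y + d z w ≤ max (d x z + d y w) (d x w + d y z) + δ
  exists_between : ∀ x y (n : ℕ), (n : ℤ) ≤ d x y → ∃ m, d x m = n ∧ d m y = d x y - n
  finite_ball : ∀ r : ℤ, {g | d 1 g ≤ r}.Finite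

namespace HyperbolicMetric

variable {G : Type*} [Group G] (M : HyperbolicMetric G)

theorem d_inv_left (g x y : G) : M.d (g⁻¹ * x) y = M.d x (g * y) := by
  rw [← M.mul_left g]; simp

theorem d_one_inv (g : G) : M.d 1 g⁻¹ = M.d 1 g := by
  rw [← M.mul_left g, M.comm]; simp

/-- In the four-point inequality for `1, k², k, k ^ (n + 2)`, the gap hypothesis and the induction
hypothesis exclude the branch with `k ^ n`; the other branch is the claim. Orbits of such `k` thus
escape to infinity, so `k` has infinite order. -/
theorem d_one_pow_succ {k : G} (hk : M.d 1 k + M.δ + 1 ≤ M.d 1 (k ^ 2)) (n : ℕ) :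
    M.d 1 (k ^ n) + 1 ≤ M.d 1 (k ^ (n + 1)) := by
  induction n with
  | zero =>
    have h1 := M.triangle 1 k (k ^ 2)
    have h2 : M.d k (k ^ 2) = M.d 1 k := by
      rw [← M.mul_left k 1 k, mul_one, pow_two]
    simp only [pow_zero, M.self, zero_add, pow_one]
    have := M.nonneg 1 k
    omega
  | succ n ih =>
    have h := M.fourPoint 1 (k ^ 2) k (k ^ (n + 2))
    have e1 : M.d k (k ^ (n + 2)) = M.d 1 (k ^ (n + 1)) := by
      rw [← M.mul_left k 1, mul_one, ← pow_succ']
    have e2 : M.d (k ^ 2) (k ^ (n + 2)) = M.d 1 (k ^ n) := by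
      rw [← M.mul_left (k ^ 2) 1, mul_one, ← pow_add, add_comm]
    have e3 : M.d (k ^ 2) k = M.d 1 k := by
      rw [M.comm, ← M.mul_left k 1 k, mul_one, pow_two]
    rw [e1, e2, e3] at h
    rcases max_cases (M.d 1 k + M.d 1 (k ^ n)) (M.d 1 (k ^ (n + 2)) + M.d 1 k) with h' | h' <;>
      simp only [add_assoc, Nat.reduceAdd] at * <;> omega

theorem add_le_d_one_pow_add {k : G} (hk : M.d 1 k + M.δ + 1 ≤ M.d 1 (k ^ 2)) (n m : ℕ) :
    M.d 1 (k ^ n) + m ≤ M.d 1 (k ^ (n + m)) := by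
  induction m with
  | zero => simp
  | succ m ih =>
    have := M.d_one_pow_succ hk (n + m)
    rw [← add_assoc]
    push_cast
    omega

theorem d_one_sq_le_of_isOfFinOrder {k : G} (hk : IsOfFinOrder k) :
    M.d 1 (k ^ 2) ≤ M.d 1 k + M.δ := by
  by_contra! h
  obtain ⟨n, hn, h1⟩ := isOfFinOrder_iff_pow_eq_one.1 hk
  have := M.add_le_d_one_pow_add (k := k) (by omega) 0 n
  simp only [pow_zero, zero_add, h1, M.self] at this
  omega

theorem d_sq_mul_le_of_isOfFinOrder {k : G} (hk : IsOfFinOrder k) (x : G) :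
    M.d x (k * k * x) ≤ M.d x (k * x) + M.δ := by
  have h : IsOfFinOrder (x⁻¹ * k * x) := by
    obtain ⟨n, hn, h1⟩ := isOfFinOrder_iff_pow_eq_one.1 hk
    refine isOfFinOrder_iff_pow_eq_one.2 ⟨n, hn, ?_⟩
    have := conj_pow (a := x⁻¹) (b := k) (i := n)
    rw [inv_inv] at this
    simp [this, h1]
  have h2 := M.d_one_sq_le_of_isOfFinOrder h
  rw [← M.mul_left x 1, ← M.mul_left x 1 (x⁻¹ * k * x)] at h2
  simpa [pow_two, mul_assoc] using h2

/-- The midpoint of `[1, g]` is almost fixed by all `h` that move `1` at most as far as `g` does. -/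
theorem d_midpoint_le {H : Subgroup G}
    (hH : ∀ h ∈ H, ∀ x, M.d x (h * h * x) ≤ M.d x (h * x) + M.δ) {g m : G} (hg : g ∈ H)
    {l : ℕ} (hm : M.d 1 m = l) (hm' : M.d m g = M.d 1 g - l)
    (hl : 2 * (l : ℤ) ≤ M.d 1 g) (hl' : M.d 1 g ≤ 2 * l + 1) {h : G} (hh : h ∈ H)
    (hle : M.d 1 h ≤ M.d 1 g) : M.d m (h * m) ≤ 20 * M.δ + 20 := by
  set D := M.d 1 g
  -- `g` almost fixes `m`
  have hgm : M.d m (g * m) ≤ 3 * M.δ + 1 := by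
    have f1 := M.fourPoint 1 (g * m) g (g * g)
    have f2 := M.fourPoint m (g * m) 1 g
    have e1 : M.d g (g * g) = D := by simpa using M.mul_left g 1 g
    have e2 : M.d (g * m) (g * g) = D - l := by rw [M.mul_left, hm']
    have e3 : M.d (g * m) g = l := by
      rw [M.comm, ← hm, ← M.mul_left g 1 m, mul_one]
    have e4 : M.d 1 (g * g) ≤ D + M.δ := by
      simpa using hH g hg 1
    rw [M.comm m 1, M.comm (g * m) 1] at f2
    change _ ≤ max (D + _) _ + _ at f1
    omega
  set T := M.d m (h * m)
  -- If `T` is large, `h * m` branches off `[1, g]` at `m`, so it is far from `1` or from `g`. In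
  -- the second case, apply `g`, which almost fixes `m` and sends `1` to `g`: comparing `h * m` with
  -- `g * h * m` shows that `h * m` is far from `1` as well.
  have key : ∀ h ∈ H, M.d m (h * m) = T →
      T ≤ 20 * M.δ + 20 ∨ l + T - 5 * M.δ - 5 ≤ M.d 1 (h * m) := by
    intro h hh hT
    have a1 : M.d (h * m) (h⁻¹ * m) ≤ T + M.δ := by
      have := hH h hh m
      rw [M.comm, M.d_inv_left, ← mul_assoc]
      omega
    have a2 : M.d m (g * h * m) ≤ T + 3 * M.δ + 1 := by
      have := M.triangle m (g * m) (g * h * m)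
      rw [mul_assoc g h m, M.mul_left, hT] at this
      rw [mul_assoc]
      omega
    have a2' : T - 3 * M.δ - 1 ≤ M.d m (g * h * m) := by
      have := M.triangle (g * m) m (g * h * m)
      rw [mul_assoc g h m, M.mul_left, hT, M.comm (g * m)] at this
      rw [mul_assoc]
      omega
    have a3 : M.d (h⁻¹ * m) (g * h * m) ≤ T + 7 * M.δ + 2 := by
      have b1 := hH (g * h) (H.mul_mem hg hh) m
      have b2 := M.triangle (h⁻¹ * m) (h⁻¹ * (g⁻¹ * m)) (g * h * m)
      have b3 : M.d (h⁻¹ * m) (h⁻¹ * (g⁻¹ * m)) = M.d m (g * m) := by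
        rw [M.mul_left, M.comm, M.d_inv_left]
      have b4 : M.d (h⁻¹ * (g⁻¹ * m)) (g * h * m) = M.d m (g * h * (g * h) * m) := by
        rw [M.d_inv_left, M.d_inv_left]; simp [mul_assoc]
      omega
    have a4 : M.d (h * m) (g * h * m) ≤ T + 8 * M.δ + 2 := by
      have b1 := M.fourPoint (h * m) (g * h * m) m (h⁻¹ * m)
      have b2 : M.d m (h⁻¹ * m) = T := by rw [M.comm, M.d_inv_left, hT]
      rw [M.comm (h * m) m, M.comm (g * h * m) m, M.comm (g * h * m) (h⁻¹ * m), b2, hT] at b1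
      omega
    have a5 := M.fourPoint 1 g m (h * m)
    have a6 := M.fourPoint g (h * m) m (g * h * m)
    have a7 : M.d g (g * h * m) = M.d 1 (h * m) := by
      rw [← M.mul_left g 1, mul_one, mul_assoc]
    rw [M.comm g m, M.comm (h * m) m, a7, hm', hT] at a6
    rw [M.comm g m, hT, hm, hm'] at a5
    change D + T ≤ _ at a5
    omega
  have hT' : M.d m (h⁻¹ * m) = T := by rw [M.comm, M.d_inv_left]
  have e : M.d 1 (h⁻¹ * m) = M.d h m := by
    rw [M.comm, M.d_inv_left, M.comm, mul_one]
  have k1 := key h hh rfl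
  have k2 := key h⁻¹ (H.inv_mem hh) hT'
  rw [e] at k2
  -- By `key` for `h` and `h⁻¹`, the left side is about `2 * l + 2 * T`, while the right side is at
  -- most about `2 * l + T`; so `T` is bounded.
  have f := M.fourPoint 1 (h * m) m h
  have e2 : M.d (h * m) h = l := by rw [M.comm, ← hm, ← M.mul_left h 1 m, mul_one]
  rw [M.comm (h * m) m, M.comm m h, e2, hm] at f
  change _ ≤ max _ (_ + T) + _ at f
  omega

/-- A subgroup without strictly hyperbolic elements is finite, and conjugate into a ball of fixed
radius. -/
theorem exists_conj_mem_ball {H : Subgroup G}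
    (hH : ∀ h ∈ H, ∀ x, M.d x (h * h * x) ≤ M.d x (h * x) + M.δ) :
    Finite H ∧ ∃ x : G, ∀ h ∈ H, M.d 1 (x⁻¹ * h * x) ≤ 20 * M.δ + 20 := by
  have mid : ∀ g ∈ H, ∃ m : G, ∀ h ∈ H, M.d 1 h ≤ M.d 1 g →
      M.d 1 (m⁻¹ * h * m) ≤ 20 * M.δ + 20 := by
    intro g hg
    have h0 := M.nonneg 1 g
    obtain ⟨m, hm, hm'⟩ := M.exists_between 1 g (M.d 1 g / 2).toNat (by omega)
    refine ⟨m, fun h hh hle => ?_⟩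
    have := M.d_midpoint_le hH hg hm hm' (by omega) (by omega) hh hle
    rwa [← M.mul_left m 1, mul_one, mul_assoc, mul_inv_cancel_left]
  have hfin : (H : Set G).Finite := by
    by_contra hinf
    set B := M.finite_ball (20 * M.δ + 20)
    -- An infinite `H` contains more elements than the ball does, and also an element `g` moving `1`
    -- further than all of them. Conjugation by the midpoint of `[1, g]` would inject them into the
    -- ball.
    obtain ⟨s, hs, hcard⟩ := Set.Infinite.exists_subset_card_eq hinf (B.toFinset.card + 1)
    obtain ⟨r, hr⟩ : ∃ r : ℤ, ∀ h ∈ s, M.d 1 h ≤ r := by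
      obtain ⟨r, hr⟩ := (s.image (M.d 1)).bddAbove
      exact ⟨r, fun h hh => hr (by simpa using ⟨h, hh, rfl⟩)⟩
    obtain ⟨g, hg, hgr⟩ : ∃ g ∈ H, r < M.d 1 g := by
      by_contra! hc
      exact hinf ((M.finite_ball r).subset hc)
    obtain ⟨m, hm⟩ := mid g hg
    have : s.card ≤ B.toFinset.card := by
      refine Finset.card_le_card_of_injOn (fun h => m⁻¹ * h * m) (fun h hh => ?_) ?_
      · simpa using hm h (hs hh) ((hr h hh).trans hgr.le)
      · intro a _ b _ hab
        simpa using hab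
    omega
  refine ⟨hfin, ?_⟩
  obtain ⟨g, hg, hmax⟩ := Set.exists_max_image (H : Set G) (M.d 1) hfin ⟨1, H.one_mem⟩
  obtain ⟨m, hm⟩ := mid g hg
  exact ⟨m, fun h hh => hm h hh (hmax h hh)⟩

/-- Suppose `h` is at least as long as `k ^ N`. In the parallelogram `1, k ^ n, k ^ n * h, h` with
`n = ±N`, one diagonal is at least `|h|` by minimality, so the other is at most `|h| + δ`. The
four-point inequality for `1, h, k ^ N, k ^ (-N)` then bounds `|k ^ (2N)|` by `|k ^ N| + 2δ`,
contradicting growth since `N = 2δ + 1`. -/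
theorem d_one_lt_of_commute {k h : G} (hk : M.d 1 k + M.δ + 1 ≤ M.d 1 (k ^ 2))
    (hc : Commute k h) (hmin : ∀ n : ℤ, M.d 1 h ≤ M.d 1 (k ^ n * h)) :
    M.d 1 h < M.d 1 (k ^ (2 * M.δ + 1)) := by
  by_contra! hle
  set N := 2 * M.δ + 1
  have gap := M.add_le_d_one_pow_add hk N N
  have e0 : ∀ n : ℤ, M.d (k ^ n) h = M.d 1 (k ^ (-n) * h) := by
    intro n
    rw [← M.mul_left (k ^ n) 1, mul_one, ← mul_assoc, ← zpow_add]; simp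
  have diag : ∀ n : ℤ, M.d 1 (k ^ n) ≤ M.d 1 h → M.d 1 (k ^ n * h) ≤ M.d 1 h + M.δ := by
    intro n hn
    have f := M.fourPoint 1 (k ^ n * h) (k ^ n) h
    have e1 : M.d (k ^ n * h) (k ^ n) = M.d 1 h := by
      rw [M.comm, ← M.mul_left (k ^ n) 1, mul_one]
    have e2 : M.d (k ^ n * h) h = M.d 1 (k ^ n) := by
      rw [(hc.zpow_left n).eq, M.comm, ← M.mul_left h 1, mul_one]
    have := hmin (-n)
    rw [e1, e2, e0] at f
    omega
  have hN : M.d 1 (k ^ (N : ℤ)) ≤ M.d 1 h := by rwa [zpow_natCast]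
  have hN' : M.d 1 (k ^ (-(N : ℤ))) ≤ M.d 1 h := by rwa [zpow_neg, M.d_one_inv]
  have f := M.fourPoint 1 h (k ^ (N : ℤ)) (k ^ (-(N : ℤ)))
  have e1 : M.d (k ^ (N : ℤ)) (k ^ (-(N : ℤ))) = M.d 1 (k ^ (N + N)) := by
    rw [M.comm, ← M.mul_left (k ^ (N : ℤ)), ← zpow_add, ← zpow_add, add_neg_cancel, zpow_zero,
      ← zpow_natCast k (N + N), Nat.cast_add N N]
  have e2 : M.d 1 (k ^ (-(N : ℤ))) = M.d 1 (k ^ N) := by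
    rw [zpow_neg, M.d_one_inv, zpow_natCast]
  have d1 := diag _ hN
  have d2 := diag _ hN'
  rw [M.comm h, M.comm h, e0, e0, neg_neg, e1, e2, zpow_natCast] at f
  rw [zpow_natCast] at d1
  omega

theorem finite_and_exists_conj_mem_ball {H : Subgroup G} (hH : ∀ h ∈ H, IsOfFinOrder h) :
    Finite H ∧ ∃ x : G, ∀ h ∈ H, M.d 1 (x⁻¹ * h * x) ≤ 20 * M.δ + 20 :=
  M.exists_conj_mem_ball fun h hh => M.d_sq_mul_le_of_isOfFinOrder (hH h hh)

/-- Some power of an element of infinite order is conjugate to an element that is strictly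
hyperbolic at `1`. -/
theorem exists_zpow_sq_gap {g : G} (hg : ¬ IsOfFinOrder g) :
    ∃ n : ℤ, ∃ x, M.d 1 (x⁻¹ * g ^ n * x) + M.δ + 1 ≤ M.d 1 ((x⁻¹ * g ^ n * x) ^ 2) := by
  by_contra! hc
  have h := M.exists_conj_mem_ball (H := Subgroup.zpowers g) (by
    rintro _ ⟨n, rfl⟩ x
    have := hc n x
    rw [← M.mul_left x 1, ← M.mul_left x 1 (x⁻¹ * g ^ n * x)] at this
    simp only [pow_two, mul_one, mul_assoc, mul_inv_cancel_left] at this ⊢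
    omega)
  exact hg (finite_zpowers.1 h.1)

/-- The centralizer of an element of infinite order is virtually generated by it. -/
theorem relIndex_zpowers_centralizer_ne_zero (M : HyperbolicMetric G) {g : G}
    (hg : ¬ IsOfFinOrder g) :
    (Subgroup.zpowers g).relIndex (Subgroup.centralizer {g}) ≠ 0 := by
  obtain ⟨n, x, hx⟩ := M.exists_zpow_sq_gap hg
  set k := x⁻¹ * g ^ n * x with hk
  have hkpow : ∀ j : ℤ, k ^ j = x⁻¹ * g ^ (n * j) * x := by
    intro j
    have := conj_zpow (a := x⁻¹) (b := g ^ n) (i := j)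
    rw [inv_inv] at this
    rw [hk, this, zpow_mul]
  set r := M.d 1 (k ^ (2 * M.δ + 1))
  -- A shortest element of the coset `⟨k⟩ h`, for `h` the conjugate of `y` by `x⁻¹`, lies in the
  -- ball of radius `r`; hence finitely many cosets of `⟨g⟩` suffice.
  have cover : ∀ y ∈ Subgroup.centralizer {g}, ∃ m : ℤ, M.d 1 (x⁻¹ * (g ^ m * y) * x) ≤ r := by
    intro y hy
    have hgy : Commute g y := Subgroup.mem_centralizer_singleton_iff.1 hy |>.symm
    set h := x⁻¹ * y * x with hh
    have hc : Commute k h := by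
      have := (hgy.zpow_left n).eq
      change x⁻¹ * g ^ n * x * (x⁻¹ * y * x) = x⁻¹ * y * x * (x⁻¹ * g ^ n * x)
      simp only [mul_assoc, mul_inv_cancel_left]
      rw [← mul_assoc (g ^ n), this, mul_assoc]
    obtain ⟨j, hj⟩ : ∃ j : ℤ, ∀ i : ℤ, M.d 1 (k ^ j * h) ≤ M.d 1 (k ^ i * h) := by
      let f : ℤ → ℕ := fun j => (M.d 1 (k ^ j * h)).toNat
      refine ⟨Function.argmin f, fun i => ?_⟩
      have h1 : f (Function.argmin f) ≤ f i := Function.argmin_le f i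
      have h2 := M.nonneg 1 (k ^ i * h)
      simp only [f] at h1 ⊢
      omega
    refine ⟨n * j, ?_⟩
    have := M.d_one_lt_of_commute hx (((Commute.refl k).zpow_right j).mul_right hc) (by
      intro i
      have e : k ^ i * (k ^ j * h) = k ^ (i + j) * h := by rw [zpow_add, mul_assoc]
      rw [e]
      exact hj _)
    rw [hkpow, hh] at this
    simp only [mul_assoc, mul_inv_cancel_left] at this ⊢
    exact this.le
  have hB : {z : Subgroup.centralizer {g} | M.d 1 (x⁻¹ * z * x) ≤ r}.Finite :=
    Set.Finite.preimage (f := fun z : Subgroup.centralizer {g} => x⁻¹ * (z : G) * x)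
      (fun a _ b _ hab => by simpa using hab) (M.finite_ball r)
  have := hB.to_subtype
  rw [Subgroup.relIndex]
  suffices h : Finite (Subgroup.centralizer {g} ⧸
      (Subgroup.zpowers g).subgroupOf (Subgroup.centralizer {g})) from
    Subgroup.index_ne_zero_of_finite
  refine Finite.of_surjective
    (fun z : {z : Subgroup.centralizer {g} | M.d 1 (x⁻¹ * z * x) ≤ r} => (QuotientGroup.mk z.1 :
      Subgroup.centralizer {g} ⧸ (Subgroup.zpowers g).subgroupOf (Subgroup.centralizer {g}))) ?_
  intro q
  induction q using QuotientGroup.induction_on with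
  | H y =>
    obtain ⟨m, hm⟩ := cover y y.2
    have hgy : Commute g (y : G) := (Subgroup.mem_centralizer_singleton_iff.1 y.2).symm
    have hgm : g ^ m ∈ Subgroup.centralizer {g} :=
      Subgroup.mem_centralizer_singleton_iff.2 ((Commute.refl g).zpow_left m).eq
    refine ⟨⟨⟨g ^ m, hgm⟩ * y, hm⟩, ?_⟩
    refine QuotientGroup.eq.2 ?_
    rw [Subgroup.mem_subgroupOf]
    refine ⟨-m, ?_⟩
    have := (hgy.zpow_left (-m)).eq
    simp only [Subgroup.coe_mul, Subgroup.coe_inv, mul_inv_rev, mul_assoc]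
    rw [← zpow_neg, this, inv_mul_cancel_left]

end HyperbolicMetric

/-! ### The word metric of a hyperbolic group -/

section WordMetric

variable {G : Type*} [Group G] {S : Set G}

theorem mulCayley_connected (hS : Subgroup.closure S = ⊤) :
    (SimpleGraph.mulCayley S).Connected := by
  have step : ∀ x : G, ∀ s ∈ S, (SimpleGraph.mulCayley S).Reachable x (x * s) := by
    intro x s hs
    by_cases h : x = x * s
    · rw [← h]
    · exact SimpleGraph.Adj.reachable ((SimpleGraph.mulCayley_adj' S _ _).2 ⟨h, s, hs, Or.inl rfl⟩)
  have h1 : ∀ g : G, ∀ x, (SimpleGraph.mulCayley S).Reachable x (x * g) := by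
    intro g
    have hg : g ∈ Subgroup.closure S := hS ▸ Subgroup.mem_top g
    induction hg using Subgroup.closure_induction with
    | mem s hs => exact fun x => step x s hs
    | one => intro x; rw [mul_one]
    | mul a b _ _ ha hb =>
      intro x
      rw [← mul_assoc]
      exact (ha x).trans (hb _)
    | inv a _ ha =>
      intro x
      simpa using (ha (x * a⁻¹)).symm
  exact { preconnected := fun x y => by simpa using h1 (x⁻¹ * y) x }

theorem mulCayley_dist_mul_left (hc : (SimpleGraph.mulCayley S).Connected) (g x y : G) :
    (SimpleGraph.mulCayley S).dist (g * x) (g * y) = (SimpleGraph.mulCayley S).dist x y := by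
  have le : ∀ g x y : G,
      (SimpleGraph.mulCayley S).dist (g * x) (g * y) ≤ (SimpleGraph.mulCayley S).dist x y := by
    intro g x y
    obtain ⟨w, hw⟩ := hc.exists_walk_length_eq_dist x y
    let f : SimpleGraph.mulCayley S →g SimpleGraph.mulCayley S :=
      ⟨(g * ·), (SimpleGraph.mulCayley_adj_mul_iff_right).2⟩
    rw [← hw, ← SimpleGraph.Walk.length_map f w]
    exact SimpleGraph.dist_le (w.map f)
  refine le_antisymm (le g x y) ?_
  simpa using le g⁻¹ (g * x) (g * y)

theorem mulCayley_exists_between (hc : (SimpleGraph.mulCayley S).Connected) (x y : G) {n : ℕ}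
    (hn : n ≤ (SimpleGraph.mulCayley S).dist x y) :
    ∃ m, (SimpleGraph.mulCayley S).dist x m = n ∧
      (SimpleGraph.mulCayley S).dist m y = (SimpleGraph.mulCayley S).dist x y - n := by
  obtain ⟨p, hp⟩ := hc.exists_walk_length_eq_dist x y
  have h1 := SimpleGraph.dist_le (p.take n)
  have h2 := SimpleGraph.dist_le (p.drop n)
  have h3 := hc.dist_triangle (u := x) (v := p.getVert n) (w := y)
  rw [SimpleGraph.Walk.take_length] at h1
  rw [SimpleGraph.Walk.drop_length] at h2
  exact ⟨p.getVert n, by omega, by omega⟩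

theorem mulCayley_finite_ball (hc : (SimpleGraph.mulCayley S).Connected) (hS : S.Finite) (n : ℕ) :
    {g | (SimpleGraph.mulCayley S).dist 1 g ≤ n}.Finite := by
  induction n with
  | zero =>
    refine (Set.finite_singleton 1).subset fun g hg => ?_
    exact (hc.dist_eq_zero_iff.1 (Nat.le_zero.1 hg)).symm
  | succ n ih =>
    refine (ih.union (ih.mul (hS.union hS.inv))).subset fun g hg => ?_
    rcases Nat.lt_or_ge n ((SimpleGraph.mulCayley S).dist 1 g) with h | h
    · obtain ⟨m, hm, hm'⟩ := mulCayley_exists_between hc 1 g h.le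
      have hg' : (SimpleGraph.mulCayley S).dist 1 g ≤ n + 1 := hg
      have hadj : (SimpleGraph.mulCayley S).Adj m g :=
        SimpleGraph.dist_eq_one_iff_adj.1 (by omega)
      refine Or.inr (Set.mem_mul.2 ⟨m, hm.le, m⁻¹ * g, ?_, by simp⟩)
      rcases ((SimpleGraph.mulCayley_adj S _ _).1 hadj).2 with h' | h'
      · exact Or.inl h'
      · exact Or.inr (by simpa using h')
    · exact Or.inl h

theorem IsHyperbolicGroup.nonempty_hyperbolicMetric (h : IsHyperbolicGroup G) :
    Nonempty (HyperbolicMetric G) := by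
  obtain ⟨S, hS, hgen, δ, hδ⟩ := h
  have hc := mulCayley_connected hgen
  refine ⟨{
    d := fun x y => (SimpleGraph.mulCayley S).dist x y
    δ := δ
    nonneg := fun _ _ => by positivity
    self := fun _ => by simp
    comm := fun _ _ => by rw [SimpleGraph.dist_comm]
    triangle := fun _ _ _ => by exact_mod_cast hc.dist_triangle
    mul_left := fun _ _ _ => by rw [mulCayley_dist_mul_left hc]
    fourPoint := fun x y z w => by exact_mod_cast hδ x y z w
    exists_between := fun x y n hn => ?_
    finite_ball := fun r => ?_ }⟩
  · obtain ⟨m, h1, h2⟩ := mulCayley_exists_between hc x y (Nat.cast_le.1 hn)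
    exact ⟨m, by simp [h1], by rw [h2, Nat.cast_sub (Nat.cast_le.1 hn)]⟩
  · refine (mulCayley_finite_ball hc hS r.toNat).subset fun g hg => ?_
    simp only [Set.mem_ofPred_eq] at hg ⊢
    omega

end WordMetric

/-! ### Virtually cyclic subgroups -/

/-- Torsion subgroups of `G` are finite, of order at most `B`. -/
def TorsionBounded (G : Type*) [Group G] (B : ℕ) : Prop :=
  ∀ H : Subgroup G, (∀ h ∈ H, IsOfFinOrder h) → Finite H ∧ Nat.card H ≤ B

/-- An exponent that is large with respect to a bound `B` on the orders of finite subgroups. -/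
def largeExponent (B : ℕ) : ℕ := 2 * (B.factorial * B.factorial)

theorem largeExponent_pos (B : ℕ) : 0 < largeExponent B := by
  have := B.factorial_pos
  unfold largeExponent
  positivity

theorem isOfFinOrder_of_mem_finite {G : Type*} [Group G] (H : Subgroup G) [Finite H] {x : G}
    (hx : x ∈ H) : IsOfFinOrder x :=
  H.subtype.isOfFinOrder (isOfFinOrder_of_finite (⟨x, hx⟩ : H))

theorem TorsionBounded.mono {G : Type*} [Group G] {B B' : ℕ} (h : TorsionBounded G B)
    (hB : B ≤ B') : TorsionBounded G B' :=
  fun H hH => ⟨(h H hH).1, (h H hH).2.trans hB⟩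

theorem TorsionBounded.card_le {G : Type*} [Group G] {B : ℕ} (h : TorsionBounded G B)
    (H : Subgroup G) [Finite H] : Nat.card H ≤ B :=
  (h H fun _ hx => isOfFinOrder_of_mem_finite H hx).2

theorem TorsionBounded.subgroup {G : Type*} [Group G] {B : ℕ} (h : TorsionBounded G B)
    (N : Subgroup G) : TorsionBounded N B := by
  intro H hH
  have := h (H.map N.subtype) (by
    rintro _ ⟨x, hx, rfl⟩
    exact N.subtype.isOfFinOrder (hH x hx))
  have e := (H.equivMapOfInjective N.subtype N.subtype_injective).toEquiv
  have hf := this.1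
  exact ⟨Finite.of_equiv _ e.symm, by rw [Nat.card_congr e]; exact this.2⟩

theorem pow_factorial_eq_one {G : Type*} [Group G] {B : ℕ} (H : Subgroup G) [Finite H]
    (hB : Nat.card H ≤ B) {x : G} (hx : x ∈ H) : x ^ B.factorial = 1 := by
  obtain ⟨k, hk⟩ := Nat.dvd_factorial Nat.card_pos hB
  have : (⟨x, hx⟩ : H) ^ Nat.card H = 1 := pow_card_eq_one'
  have h1 : x ^ Nat.card H = 1 := congrArg Subtype.val this
  rw [hk, pow_mul, h1, one_pow]

/-- This turns infinite order into a single quantifier-free inequation. -/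
theorem TorsionBounded.pow_largeExponent_ne_one_iff {G : Type*} [Group G] {B : ℕ}
    (h : TorsionBounded G B) (x : G) : x ^ largeExponent B ≠ 1 ↔ ¬ IsOfFinOrder x := by
  rw [not_iff_not]
  constructor
  · exact fun hx => isOfFinOrder_iff_pow_eq_one.2 ⟨_, largeExponent_pos B, hx⟩
  · intro hx
    have : Finite (Subgroup.zpowers x) := finite_zpowers.2 hx
    have := pow_factorial_eq_one _ (h.card_le _) (Subgroup.mem_zpowers x)
    rw [largeExponent, mul_comm, mul_assoc, pow_mul, this, one_pow]

/-- If commutators lie in a normal subgroup of order at most `B`, then large powers are central. -/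
theorem commute_pow_of_commutator_mem {G : Type*} [Group G] {B : ℕ} (T : Subgroup G) [T.Normal]
    [Finite T] (hB : Nat.card T ≤ B) {x y : G} (hT : ∀ u : G, u * y * u⁻¹ * y⁻¹ ∈ T) :
    Commute (x ^ (B.factorial * B.factorial)) y := by
  set u := x ^ B.factorial with hu
  have hcomm : ∀ t ∈ T, Commute u t := by
    intro t ht
    -- Conjugation by `x` permutes `T`, so its order divides `|T|!` and hence `B!`. The first factor
    -- `B!` makes `u` centralize `T`; the second kills the commutator `c`.
    let φ : G →* Equiv.Perm T := (MulAut.toPerm T).comp MulAut.conjNormal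
    have h1 : φ x ^ B.factorial = 1 := by
      have : φ x ^ Nat.card (Equiv.Perm T) = 1 := pow_card_eq_one'
      rw [Nat.card_perm] at this
      obtain ⟨k, hk⟩ := Nat.factorial_dvd_factorial hB
      rw [hk, pow_mul, this, one_pow]
    rw [← map_pow] at h1
    have h2 : ((φ u) ⟨t, ht⟩ : G) = t := by rw [hu, h1]; rfl
    have h3 : u * t * u⁻¹ = t := h2
    exact mul_inv_eq_iff_eq_mul.1 h3
  set c := u * y * u⁻¹ * y⁻¹ with hc
  have hcT : c ∈ T := hT u
  have key : ∀ m : ℕ, u ^ m * y = c ^ m * y * u ^ m := by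
    intro m
    induction m with
    | zero => simp
    | succ m ih =>
      have e1 : u * y = c * y * u := by rw [hc]; group
      have e2 : u * c ^ m = c ^ m * u := ((hcomm c hcT).pow_right m).eq
      calc u ^ (m + 1) * y = u * (u ^ m * y) := by rw [pow_succ']; group
        _ = u * c ^ m * y * u ^ m := by rw [ih]; group
        _ = c ^ m * (u * y) * u ^ m := by rw [e2]; group
        _ = c ^ (m + 1) * y * u ^ (m + 1) := by rw [e1, pow_succ c, pow_succ' u]; group
  have := key B.factorial
  rw [pow_factorial_eq_one T hB hcT, one_mul] at this
  rw [pow_mul]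
  exact this

/-- The transfer to the center is a power map, so its kernel is torsion, hence finite of order at
most `B`; it contains all commutators because the center is abelian. -/
theorem commute_pow_of_finiteIndex_center {G : Type*} [Group G] {B : ℕ} (hG : TorsionBounded G B)
    [(Subgroup.center G).FiniteIndex] (x y : G) :
    Commute (x ^ (B.factorial * B.factorial)) y := by
  set T := (MonoidHom.transferCenterPow G).ker
  have hT : ∀ h ∈ T, IsOfFinOrder h := by
    intro h hh
    refine isOfFinOrder_iff_pow_eq_one.2
      ⟨_, Nat.pos_of_ne_zero (Subgroup.FiniteIndex.index_ne_zero (H := Subgroup.center G)), ?_⟩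
    rw [← MonoidHom.transferCenterPow_apply, MonoidHom.mem_ker.1 hh]; rfl
  obtain ⟨hf, hc⟩ := hG T hT
  refine commute_pow_of_commutator_mem T hc fun u => ?_
  open scoped IsMulCommutative in
  rw [MonoidHom.mem_ker, map_mul, map_mul, map_mul, map_inv, map_inv, mul_inv_cancel_comm,
    mul_inv_cancel]

/-- If some element has infinite order, the group has a normal infinite cyclic subgroup `⟨w⟩` of
finite index. Conjugation sends `w` to `w` or `w⁻¹`, so squares lie in the centralizer of `w`, whose
center has finite index. This explains the factor `2` in `largeExponent`. -/
theorem IsVirtuallyCyclic.commute_pow {G : Type*} [Group G] {B : ℕ} (h : IsVirtuallyCyclic G)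
    (hG : TorsionBounded G B) (x y : G) :
    Commute (x ^ largeExponent B) (y ^ largeExponent B) := by
  by_cases hx : IsOfFinOrder x
  · rw [of_not_not fun h => (hG.pow_largeExponent_ne_one_iff x).1 h hx]
    exact Commute.one_left _
  obtain ⟨H, hcyc, hfin⟩ := h
  have hcyc' : IsCyclic H.normalCore :=
    isCyclic_of_injective (Subgroup.inclusion H.normalCore_le) (Subgroup.inclusion_injective _)
  obtain ⟨⟨w, hw⟩, hgen⟩ := hcyc'
  have hgen' : ∀ v ∈ H.normalCore, ∃ n : ℤ, w ^ n = v := by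
    intro v hv
    obtain ⟨n, hn⟩ := hgen ⟨v, hv⟩
    exact ⟨n, congrArg Subtype.val hn⟩
  have hwinf : ¬ IsOfFinOrder w := by
    intro hwf
    obtain ⟨m, hm, -, hxm⟩ := Subgroup.exists_pow_mem_of_index_ne_zero
      (Subgroup.FiniteIndex.index_ne_zero (H := H.normalCore)) x
    obtain ⟨n, hn⟩ := hgen' _ hxm
    have : IsOfFinOrder (x ^ m) := hn ▸ hwf.zpow
    exact hx (this.of_pow hm.ne')
  have hinj := injective_zpow_iff_not_isOfFinOrder.2 hwinf
  set C := Subgroup.centralizer {w}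
  have hsq : ∀ g : G, g ^ 2 ∈ C := by
    intro g
    obtain ⟨a, ha⟩ := hgen' _ (H.normalCore_normal.conj_mem w hw g)
    obtain ⟨b, hb⟩ := hgen' _ (H.normalCore_normal.conj_mem w hw g⁻¹)
    have e : w ^ (a * b) = w ^ (1 : ℤ) := by
      rw [zpow_mul, ha, conj_zpow, hb]; simp [mul_assoc]
    have e' : a * a = 1 := by
      rcases Int.eq_one_or_neg_one_of_mul_eq_one (hinj e) with h | h <;> simp [h]
    have e2 : g ^ 2 * w * (g ^ 2)⁻¹ = w := by
      calc g ^ 2 * w * (g ^ 2)⁻¹ = g * (g * w * g⁻¹) * g⁻¹ := by rw [pow_two]; group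
        _ = (g * w * g⁻¹) ^ a := by rw [conj_zpow, ha]
        _ = w := by rw [← ha, ← zpow_mul, e', zpow_one]
    exact Subgroup.mem_centralizer_singleton_iff.2 (mul_inv_eq_iff_eq_mul.1 e2)
  have hle : H.normalCore.subgroupOf C ≤ Subgroup.center C := by
    intro v hv
    obtain ⟨n, hn⟩ := hgen' _ (Subgroup.mem_subgroupOf.1 hv)
    refine Subgroup.mem_center_iff.2 fun g => Subtype.ext ?_
    have : Commute (g : G) w := Subgroup.mem_centralizer_singleton_iff.1 g.2
    simpa [← hn] using (this.zpow_right n).eq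
  have : (Subgroup.center C).FiniteIndex := Subgroup.finiteIndex_of_le hle
  have := commute_pow_of_finiteIndex_center (hG.subgroup C) ⟨x ^ 2, hsq x⟩
    (⟨y ^ 2, hsq y⟩ ^ (B.factorial * B.factorial))
  have := this.map C.subtype
  simpa [largeExponent, pow_mul] using this

/-- For `g` of infinite order and `a = g ^ K`, all conjugates of `a` by elements of `N` commute with
`a`, so a fixed power `z = a ^ m` is conjugated into `⟨a⟩`, say to `a ^ j n`. Since `j n` divides
`m²`, `z` has finitely many conjugates under `N`; so its centralizer has finite index in `N`, and
`⟨z⟩` has finite index in that centralizer. -/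
theorem isVirtuallyCyclic_of_commute_pow {G : Type*} [Group G]
    (htors : ∀ H : Subgroup G, (∀ h ∈ H, IsOfFinOrder h) → Finite H)
    (hcent : ∀ g : G, ¬ IsOfFinOrder g →
      (Subgroup.zpowers g).relIndex (Subgroup.centralizer {g}) ≠ 0)
    (N : Subgroup G) {K : ℕ} (hK : 0 < K)
    (hcomm : ∀ g ∈ N, ∀ h ∈ N, Commute (g ^ K) (h ^ K)) : IsVirtuallyCyclic N := by
  by_cases hN : ∀ h ∈ N, IsOfFinOrder h
  · have := htors N hN
    exact ⟨⊥, inferInstance, inferInstance⟩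
  push Not at hN
  obtain ⟨g, hg, hginf⟩ := hN
  set a := g ^ K with ha
  have haN : a ∈ N := N.pow_mem hg K
  have hainf : ¬ IsOfFinOrder a := fun h => hginf (h.of_pow hK.ne')
  have hinj := injective_zpow_iff_not_isOfFinOrder.2 hainf
  set m := ((Subgroup.zpowers a).relIndex (Subgroup.centralizer {a})).factorial with hm
  have hm0 : m ≠ 0 := Nat.factorial_ne_zero _
  have hj : ∀ n ∈ N, ∃ j : ℤ, a ^ j = n * a ^ m * n⁻¹ := by
    intro n hn
    have h1 : n * a * n⁻¹ ∈ Subgroup.centralizer {a} := by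
      rw [ha, ← conj_pow]
      -- A conjugate of `g ^ K` is the `K`-th power of a conjugate of `g`, so `hcomm` applies.
      exact Subgroup.mem_centralizer_singleton_iff.2
        (hcomm _ (N.mul_mem (N.mul_mem hn hg) (N.inv_mem hn)) g hg).eq
    have h2 := Subgroup.pow_mem_of_relIndex_ne_zero_of_dvd (hcent a hainf) h1 (n := m)
      fun k hk hk' => Nat.dvd_factorial hk hk'
    rw [conj_pow] at h2
    exact h2.1
  choose! j hj using hj
  set z := a ^ m with hz
  have hzinf : ¬ IsOfFinOrder z := fun h => hainf (h.of_pow hm0)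
  have hzN : z ∈ N := N.pow_mem haN m
  have hdvd : ∀ n ∈ N, j n * j n⁻¹ = m * m := by
    intro n hn
    refine hinj (show a ^ (j n * j n⁻¹) = a ^ ((m : ℤ) * m) from ?_)
    calc a ^ (j n * j n⁻¹) = (n * z * n⁻¹) ^ j n⁻¹ := by rw [zpow_mul, hj n hn]
      _ = n * (a ^ j n⁻¹) ^ m * n⁻¹ := by
        rw [conj_zpow, hz, ← zpow_natCast, ← zpow_natCast, ← zpow_mul, ← zpow_mul, mul_comm]
      _ = z ^ m := by rw [hj _ (N.inv_mem hn), conj_pow]; group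
      _ = a ^ ((m : ℤ) * m) := by rw [zpow_mul, zpow_natCast, zpow_natCast]
  have hCN : (Subgroup.centralizer {z}).relIndex N ≠ 0 := by
    rw [Subgroup.relIndex]
    suffices h : Finite (N ⧸ (Subgroup.centralizer {z}).subgroupOf N) from
      Subgroup.index_ne_zero_of_finite
    have hfin : {i : ℤ | i ∣ m * m}.Finite := by
      refine (Set.finite_Icc (-(m * m : ℤ)) (m * m)).subset fun i hi => ?_
      have h0 : (0 : ℤ) < m * m := by positivity
      exact ⟨by linarith [Int.le_of_dvd h0 (neg_dvd.2 hi)], Int.le_of_dvd h0 hi⟩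
    have := hfin.to_subtype
    refine Finite.of_injective (fun q : N ⧸ (Subgroup.centralizer {z}).subgroupOf N =>
      (⟨j q.out, ⟨_, (hdvd _ q.out.2).symm⟩⟩ : {i : ℤ | i ∣ m * m})) fun q q' hq => ?_
    have hq' : j q.out = j q'.out := congrArg Subtype.val hq
    have e : (q.out : G) * z * (q.out : G)⁻¹ = q'.out * z * (q'.out : G)⁻¹ := by
      rw [← hj _ q.out.2, ← hj _ q'.out.2, hq']
    rw [← q.out_eq, ← q'.out_eq, QuotientGroup.eq, Subgroup.mem_subgroupOf,
      Subgroup.mem_centralizer_singleton_iff]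
    have e' := congrArg (fun v => (q.out : G)⁻¹ * v * q'.out) e
    simpa [mul_assoc] using e'.symm
  have hle : Subgroup.zpowers z ≤ N := (Subgroup.zpowers_le).2 hzN
  have hle' : Subgroup.zpowers z ≤ Subgroup.centralizer {z} :=
    (Subgroup.zpowers_le).2 (Subgroup.mem_centralizer_singleton_iff.2 rfl)
  have hidx : (Subgroup.zpowers z).relIndex N ≠ 0 :=
    Subgroup.relIndex_ne_zero_trans (hcent z hzinf) hCN
  refine ⟨(Subgroup.zpowers z).subgroupOf N, ?_, ⟨hidx⟩⟩
  exact isCyclic_of_injective (Subgroup.subgroupOfEquivOfLe hle).toMonoidHom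
    (Subgroup.subgroupOfEquivOfLe hle).injective

/-! ### Consequences for hyperbolic groups -/

section Hyperbolic

variable {G : Type*} [Group G]

theorem IsHyperbolicGroup.exists_torsionBounded (h : IsHyperbolicGroup G) :
    ∃ B, TorsionBounded G B := by
  obtain ⟨M⟩ := h.nonempty_hyperbolicMetric
  refine ⟨(M.finite_ball (20 * M.δ + 20)).toFinset.card, fun H hH => ?_⟩
  obtain ⟨hf, x, hx⟩ := M.finite_and_exists_conj_mem_ball hH
  refine ⟨hf, ?_⟩
  rw [← Nat.card_eq_card_finite_toFinset]
  have := (M.finite_ball (20 * M.δ + 20)).to_subtype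
  refine Nat.card_le_card_of_injective
    (fun h : H => (⟨x⁻¹ * h * x, hx h h.2⟩ : {g | M.d 1 g ≤ 20 * M.δ + 20})) fun a b hab => ?_
  simpa using hab

theorem IsHyperbolicGroup.finite_finiteSubgroupClass (h : IsHyperbolicGroup G) :
    Finite (FiniteSubgroupClass G) := by
  obtain ⟨M⟩ := h.nonempty_hyperbolicMetric
  have key : ∀ c : FiniteSubgroupClass G, ∃ D : FiniteSubgroup G, D.cls = c ∧
      (D.1 : Set G) ⊆ {g | M.d 1 g ≤ 20 * M.δ + 20} := by
    intro c
    have hfin := c.rep.2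
    obtain ⟨-, x, hx⟩ := M.finite_and_exists_conj_mem_ball (H := c.rep.1) fun _ hx =>
      isOfFinOrder_of_mem_finite _ hx
    refine ⟨⟨c.rep.1.map (MulAut.conj x⁻¹).toMonoidHom,
      Set.Finite.image (MulAut.conj x⁻¹) hfin⟩, ?_, ?_⟩
    · refine Eq.trans ?_ (Quotient.out_eq (s := finiteSubgroupSetoid G) c)
      exact (Quotient.sound (s := finiteSubgroupSetoid G) ⟨x⁻¹, rfl⟩).symm
    · rintro _ ⟨y, hy, rfl⟩
      simpa using hx y hy
  choose D hD hsub using key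
  have hfin := (M.finite_ball (20 * M.δ + 20)).finite_subsets.to_subtype
  refine Finite.of_injective
    (fun c => (⟨(D c).1, hsub c⟩ : {s | s ⊆ {g | M.d 1 g ≤ 20 * M.δ + 20}})) fun c c' hcc => ?_
  have h1 : ((D c).1 : Set G) = (D c').1 := congrArg Subtype.val hcc
  rw [← hD c, ← hD c', Subtype.ext (SetLike.coe_injective h1)]

/-- The negation of the right-hand side is existential, which makes failure of virtual cyclicity
transferable. -/
theorem IsHyperbolicGroup.isVirtuallyCyclic_iff (h : IsHyperbolicGroup G) {B : ℕ}
    (hB : TorsionBounded G B) (N : Subgroup G) :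
    IsVirtuallyCyclic N ↔
      ∀ g ∈ N, ∀ h ∈ N, Commute (g ^ largeExponent B) (h ^ largeExponent B) := by
  obtain ⟨M⟩ := h.nonempty_hyperbolicMetric
  constructor
  · intro hN g hg h hh
    exact (hN.commute_pow (hB.subgroup N) ⟨g, hg⟩ ⟨h, hh⟩).map N.subtype
  · exact isVirtuallyCyclic_of_commute_pow (fun H hH => (hB H hH).1)
      (fun g hg => M.relIndex_zpowers_centralizer_ne_zero hg) N (largeExponent_pos B)

theorem TorsionBounded.infinite_iff {B : ℕ} (hB : TorsionBounded G B) (N : Subgroup G) :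
    Infinite N ↔ ∃ g ∈ N, g ^ largeExponent B ≠ 1 := by
  constructor
  · intro hN
    by_contra! hc
    refine hN.not_finite (hB N fun g hg => ?_).1
    exact isOfFinOrder_iff_pow_eq_one.2 ⟨_, largeExponent_pos B, hc g hg⟩
  · rintro ⟨g, hg, hg'⟩
    by_contra hN
    have hN := not_infinite_iff_finite.1 hN
    exact (hB.pow_largeExponent_ne_one_iff g).1 hg'
      (isOfFinOrder_of_mem_finite N hg)

end Hyperbolic

/-! ### Transfer of `∃∀`-properties -/

section Transfer

open FirstOrder.Language

variable {G G' : Type*} [Group G] [Group G'] {V : Type*}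

/-- A function on `G` and a function on `G'` that are given by the same term in the variables `V`
and one additional variable. -/
def SameTerm (t : (V → G) → G → G) (t' : (V → G') → G' → G') : Prop :=
  ∃ τ : groupLang.Term (Option V), (∀ x g, τ.realize (fun o => o.elim g x) = t x g) ∧
    ∀ x g, τ.realize (fun o => o.elim g x) = t' x g

/-- A predicate on `G` and a predicate on `G'` that are given by the same quantifier-free formula in
the variables `V` and one additional variable. -/
def SameFormula (P : (V → G) → G → Prop) (P' : (V → G') → G' → Prop) : Prop :=
  ∃ φ : groupLang.Formula (Option V), BoundedFormula.IsQF φ ∧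
    (∀ x g, φ.Realize (fun o => o.elim g x) ↔ P x g) ∧
    ∀ x g, φ.Realize (fun o => o.elim g x) ↔ P' x g

namespace SameTerm

theorem var (v : V) : SameTerm (G := G) (G' := G') (fun x _ => x v) (fun x _ => x v) :=
  ⟨Term.var (some v), fun _ _ => rfl, fun _ _ => rfl⟩

theorem last : SameTerm (G := G) (G' := G') (V := V) (fun _ g => g) (fun _ g => g) :=
  ⟨Term.var none, fun _ _ => rfl, fun _ _ => rfl⟩

theorem one : SameTerm (G := G) (G' := G') (V := V) (fun _ _ => 1) (fun _ _ => 1) :=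
  ⟨Term.func (L := groupLang) (l := 0) GroupFunc.one ![], fun _ _ => rfl, fun _ _ => rfl⟩

variable {s t : (V → G) → G → G} {s' t' : (V → G') → G' → G'}

theorem mul (hs : SameTerm s s') (ht : SameTerm t t') :
    SameTerm (fun x g => s x g * t x g) (fun x g => s' x g * t' x g) := by
  obtain ⟨σ, h1, h2⟩ := hs
  obtain ⟨τ, h3, h4⟩ := ht
  refine ⟨Term.func (L := groupLang) (l := 2) GroupFunc.mul ![σ, τ], fun x g => ?_, fun x g => ?_⟩
  · exact congrArg₂ (· * ·) (h1 x g) (h3 x g)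
  · exact congrArg₂ (· * ·) (h2 x g) (h4 x g)

theorem inv (hs : SameTerm s s') :
    SameTerm (fun x g => (s x g)⁻¹) (fun x g => (s' x g)⁻¹) := by
  obtain ⟨σ, h1, h2⟩ := hs
  refine ⟨Term.func (L := groupLang) (l := 1) GroupFunc.inv ![σ], fun x g => ?_, fun x g => ?_⟩
  · exact congrArg (·⁻¹) (h1 x g)
  · exact congrArg (·⁻¹) (h2 x g)

theorem pow (hs : SameTerm s s') (n : ℕ) :
    SameTerm (fun x g => s x g ^ n) (fun x g => s' x g ^ n) := by
  induction n with
  | zero => simpa using one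
  | succ n ih => simpa only [pow_succ] using ih.mul hs

theorem conj (hs : SameTerm s s') (ht : SameTerm t t') :
    SameTerm (fun x g => s x g * t x g * (s x g)⁻¹) (fun x g => s' x g * t' x g * (s' x g)⁻¹) :=
  (hs.mul ht).mul hs.inv

theorem eq (hs : SameTerm s s') (ht : SameTerm t t') :
    SameFormula (fun x g => s x g = t x g) (fun x g => s' x g = t' x g) := by
  obtain ⟨σ, h1, h2⟩ := hs
  obtain ⟨τ, h3, h4⟩ := ht
  refine ⟨σ.equal τ, (BoundedFormula.IsAtomic.equal _ _).isQF, fun x g => ?_, fun x g => ?_⟩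
  · rw [Formula.realize_equal, h1, h3]
  · rw [Formula.realize_equal, h2, h4]

end SameTerm

namespace SameFormula

variable {P Q : (V → G) → G → Prop} {P' Q' : (V → G') → G' → Prop}

theorem const (p : Prop) :
    SameFormula (G := G) (G' := G') (V := V) (fun _ _ => p) (fun _ _ => p) := by
  by_cases hp : p
  · exact ⟨⊤, BoundedFormula.IsQF.top, by simp [hp], by simp [hp]⟩
  · exact ⟨⊥, BoundedFormula.isQF_bot, by simp [hp], by simp [hp]⟩

theorem imp (hP : SameFormula P P') (hQ : SameFormula Q Q') :
    SameFormula (fun x g => P x g → Q x g) (fun x g => P' x g → Q' x g) := by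
  obtain ⟨φ, h0, h1, h2⟩ := hP
  obtain ⟨ψ, h0', h3, h4⟩ := hQ
  refine ⟨φ.imp ψ, h0.imp h0', fun x g => ?_, fun x g => ?_⟩
  · rw [Formula.realize_imp, h1, h3]
  · rw [Formula.realize_imp, h2, h4]

theorem not (hP : SameFormula P P') :
    SameFormula (fun x g => ¬ P x g) (fun x g => ¬ P' x g) :=
  hP.imp (const False)

theorem all {ι : Type*} [Finite ι] {P : ι → (V → G) → G → Prop} {P' : ι → (V → G') → G' → Prop}
    (hP : ∀ i, SameFormula (P i) (P' i)) :
    SameFormula (fun x g => ∀ i, P i x g) (fun x g => ∀ i, P' i x g) := by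
  choose φ h0 h1 h2 using hP
  refine ⟨Formula.iInf φ, ?_, fun x g => ?_, fun x g => ?_⟩
  · have key : ∀ l : List ι, BoundedFormula.IsQF ((l.map φ).foldr (· ⊓ ·) ⊤) := by
      intro l
      induction l with
      | nil => exact BoundedFormula.IsQF.top
      | cons i l ih => exact (h0 i).inf ih
    exact key _
  · simp only [Formula.realize_iInf, h1]
  · simp only [Formula.realize_iInf, h2]

theorem ex {ι : Type*} [Finite ι] {P : ι → (V → G) → G → Prop} {P' : ι → (V → G') → G' → Prop}
    (hP : ∀ i, SameFormula (P i) (P' i)) :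
    SameFormula (fun x g => ∃ i, P i x g) (fun x g => ∃ i, P' i x g) := by
  simpa using (all fun i => (hP i).not).not

theorem and (hP : SameFormula P P') (hQ : SameFormula Q Q') :
    SameFormula (fun x g => P x g ∧ Q x g) (fun x g => P' x g ∧ Q' x g) := by
  simpa using (hP.imp hQ.not).not

theorem relabel {W : Type*} (f : V → W) (hP : SameFormula P P') :
    SameFormula (fun x g => P (fun v => x (f v)) g) (fun x g => P' (fun v => x (f v)) g) := by
  obtain ⟨φ, h0, h1, h2⟩ := hP
  refine ⟨φ.relabel (Option.map f), h0.relabel _, fun x g => ?_, fun x g => ?_⟩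
  · rw [Formula.realize_relabel]
    refine Iff.trans (iff_of_eq (congrArg _ (funext fun o => ?_))) (h1 _ g)
    cases o <;> rfl
  · rw [Formula.realize_relabel]
    refine Iff.trans (iff_of_eq (congrArg _ (funext fun o => ?_))) (h2 _ g)
    cases o <;> rfl

end SameFormula

theorem isForallExists_alls {n : ℕ} {φ : groupLang.BoundedFormula Empty n}
    (h : IsForallExists φ) : IsForallExists φ.alls := by
  induction n with
  | zero => exact h
  | succ n ih => exact ih h.all

/-- The sentence `∀ x, ∃ g, ¬ φ(x, g)`. -/
def forallExistsNot {n : ℕ} (e : V ≃ Fin n) (φ : groupLang.Formula (Option V)) :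
    groupLang.Sentence :=
  BoundedFormula.alls (BoundedFormula.not (BoundedFormula.relabel (n := n + 1) (k := 0)
    (fun o : Option V => (Sum.inr (o.elim (Fin.last n) (fun w => (e w).castSucc)) :
      Empty ⊕ Fin (n + 1))) φ)).ex

theorem isForallExists_forallExistsNot {n : ℕ} (e : V ≃ Fin n) {φ : groupLang.Formula (Option V)}
    (hφ : BoundedFormula.IsQF φ) : IsForallExists (forallExistsNot e φ) :=
  isForallExists_alls (.of_isExistential (.ex (.of_isQF (hφ.relabel _).not)))

theorem models_forallExistsNot_iff {n : ℕ} (e : V ≃ Fin n) (φ : groupLang.Formula (Option V)) :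
    G ⊨ forallExistsNot e φ ↔ ∀ x : V → G, ∃ g, ¬ φ.Realize (fun o => o.elim g x) := by
  refine BoundedFormula.realize_alls.trans ((e.arrowCongr (Equiv.refl G)).symm.forall_congr ?_)
  intro xs
  rw [BoundedFormula.realize_ex]
  refine exists_congr fun g => ?_
  rw [BoundedFormula.realize_not, BoundedFormula.realize_relabel, Formula.Realize]
  refine not_congr (iff_of_eq (congrArg₂ _ (funext fun o => ?_) (Subsingleton.elim _ _)))
  cases o with
  | none => exact Fin.snoc_last (α := fun _ => G) g xs
  | some w => exact Fin.snoc_castSucc (α := fun _ => G) g xs (e w)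

/-- `∃∀`-properties that hold in `G` hold in `G'` if every `∀∃`-sentence true in `G'` is true
in `G`. -/
theorem SameFormula.exists_forall [Finite V] (hTh : forallExistsTheory G' ⊆ forallExistsTheory G)
    {P : (V → G) → G → Prop} {P' : (V → G') → G' → Prop} (hP : SameFormula P P')
    (h : ∃ x, ∀ g, P x g) : ∃ x, ∀ g, P' x g := by
  obtain ⟨φ, h0, h1, h2⟩ := hP
  obtain ⟨n, ⟨e⟩⟩ := Finite.exists_equiv_fin V
  by_contra! hc
  have hG' : G' ⊨ forallExistsNot e φ := (models_forallExistsNot_iff e φ).2 fun x => by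
    obtain ⟨g, hg⟩ := hc x
    exact ⟨g, fun h => hg ((h2 _ _).1 h)⟩
  have hG := (hTh ⟨isForallExists_forallExistsNot e h0, hG'⟩).2
  rw [models_forallExistsNot_iff] at hG
  obtain ⟨x, hx⟩ := h
  obtain ⟨g, hg⟩ := hG x
  exact hg ((h1 x g).2 (hx g))

end Transfer

/-! ### Expressible properties of finite subgroups -/

universe u v

instance finite_range {A H : Type*} [Group A] [Finite A] [Group H] (f : A →* H) :
    Finite f.range :=
  (Set.finite_range f).to_subtype

/-- The range of a homomorphism from a finite group, as a finite subgroup. -/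
def FiniteSubgroup.range {A H : Type*} [Group A] [Finite A] [Group H] (f : A →* H) :
    FiniteSubgroup H :=
  ⟨f.range, inferInstance⟩

section Expresses

variable {G : Type u} {G' : Type v} [Group G] [Group G']

/-- The property `Q'` of a finite subgroup of `G'` follows from an `∃∀`-property that holds for the
finite subgroup `C` of `G`. -/
def Expresses (C : FiniteSubgroup G) (Q' : FiniteSubgroup G' → Prop) : Prop :=
  ∃ (ε : Type u) (_ : Finite ε) (P : (C.1 ⊕ ε → G) → G → Prop) (P' : (C.1 ⊕ ε → G') → G' → Prop),
    SameFormula P P' ∧ (∃ e : ε → G, ∀ g, P (Sum.elim (fun a => (a : G)) e) g) ∧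
    ∀ (_ : Finite C.1) (f : C.1 →* G'), Function.Injective f → ∀ e' : ε → G',
      (∀ g, P' (Sum.elim f e') g) → Q' (FiniteSubgroup.range f)

theorem Expresses.and {C : FiniteSubgroup G} {Q₁ Q₂ : FiniteSubgroup G' → Prop}
    (h₁ : Expresses C Q₁) (h₂ : Expresses C Q₂) : Expresses C (fun D => Q₁ D ∧ Q₂ D) := by
  obtain ⟨ε₁, _, P₁, P₁', hP₁, ⟨e₁, he₁⟩, h₁⟩ := h₁
  obtain ⟨ε₂, _, P₂, P₂', hP₂, ⟨e₂, he₂⟩, h₂⟩ := h₂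
  refine ⟨ε₁ ⊕ ε₂, inferInstance, _, _,
    (hP₁.relabel (Sum.map id Sum.inl)).and (hP₂.relabel (Sum.map id Sum.inr)),
    ⟨Sum.elim e₁ e₂, fun g => ⟨?_, ?_⟩⟩, fun hfin f hf e' he' =>
      ⟨h₁ hfin f hf (e' ∘ Sum.inl) fun g => ?_, h₂ hfin f hf (e' ∘ Sum.inr) fun g => ?_⟩⟩
  · convert he₁ g using 2 with v
    cases v <;> rfl
  · convert he₂ g using 2 with v
    cases v <;> rfl
  · convert (he' g).1 using 2 with v
    cases v <;> rfl
  · convert (he' g).2 using 2 with v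
    cases v <;> rfl

theorem expresses_true (C : FiniteSubgroup G) :
    Expresses C (fun _ : FiniteSubgroup G' => True) :=
  ⟨PEmpty, inferInstance, _, _, SameFormula.const True, ⟨PEmpty.elim, fun _ => trivial⟩,
    fun _ _ _ _ _ => trivial⟩

/-- Conjugacy of two finite families of elements is expressed by a quantifier-free formula. -/
theorem sameFormula_conj {V ι κ : Type*} [Finite ι] [Finite κ] {t : (V → G) → G → G}
    {t' : (V → G') → G' → G'} (ht : SameTerm t t') (a : ι → V) (b : κ → V) :
    SameFormula (fun x g => ∀ i, ∃ j, t x g * x (a i) * (t x g)⁻¹ = x (b j))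
      (fun x g => ∀ i, ∃ j, t' x g * x (a i) * (t' x g)⁻¹ = x (b j)) :=
  .all fun i => .ex fun j => (ht.conj (.var (a i))).eq (.var (b j))

theorem mem_normalizer_iff_of_finite (C : Subgroup G) [Finite C] (g : G) :
    g ∈ Subgroup.normalizer (C : Set G) ↔ ∀ a : C, ∃ b : C, g * a * g⁻¹ = b := by
  constructor
  · exact fun hg a => ⟨⟨_, (Subgroup.mem_normalizer_iff.1 hg a).1 a.2⟩, rfl⟩
  · intro h
    refine Subgroup.mem_normalizer_fintype (S := (C : Set G)) fun n hn => ?_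
    obtain ⟨b, hb⟩ := h ⟨n, hn⟩
    rw [show g * n * g⁻¹ = b from hb]
    exact b.2

theorem mem_normalizer_range_iff {A : Type*} [Group A] [Finite A] (f : A →* G) (g : G) :
    g ∈ Subgroup.normalizer (f.range : Set G) ↔ ∀ a, ∃ b, g * f a * g⁻¹ = f b := by
  rw [mem_normalizer_iff_of_finite]
  constructor
  · intro h a
    obtain ⟨⟨_, b, rfl⟩, hb⟩ := h ⟨f a, a, rfl⟩
    exact ⟨b, hb⟩
  · rintro h ⟨_, a, rfl⟩
    obtain ⟨b, hb⟩ := h a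
    exact ⟨⟨_, b, rfl⟩, hb⟩

theorem expresses_exists_pow_ne_one (C : FiniteSubgroup G) (K : ℕ)
    (h : ∃ g ∈ Subgroup.normalizer (C.1 : Set G), g ^ K ≠ 1) :
    Expresses C (fun D : FiniteSubgroup G' =>
      ∃ g ∈ Subgroup.normalizer (D.1 : Set G'), g ^ K ≠ 1) := by
  obtain ⟨g, hg, hg'⟩ := h
  have := C.2
  refine ⟨PUnit, inferInstance, _, _,
    (sameFormula_conj (.var (Sum.inr PUnit.unit)) Sum.inl Sum.inl).and
      (((SameTerm.var (Sum.inr PUnit.unit)).pow K).eq .one).not,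
    ⟨fun _ => g, fun _ => ⟨(mem_normalizer_iff_of_finite C.1 g).1 hg, hg'⟩⟩,
    fun _ f _ e' he' => ⟨e' PUnit.unit, ?_, (he' 1).2⟩⟩
  exact (mem_normalizer_range_iff f _).2 (he' 1).1

theorem expresses_exists_not_commute (C : FiniteSubgroup G) (K : ℕ)
    (h : ¬ ∀ g ∈ Subgroup.normalizer (C.1 : Set G), ∀ h ∈ Subgroup.normalizer (C.1 : Set G),
      Commute (g ^ K) (h ^ K)) :
    Expresses C (fun D : FiniteSubgroup G' =>
      ¬ ∀ g ∈ Subgroup.normalizer (D.1 : Set G'), ∀ h ∈ Subgroup.normalizer (D.1 : Set G'),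
      Commute (g ^ K) (h ^ K)) := by
  push Not at h
  obtain ⟨g, hg, h, hh, hgh⟩ := h
  have := C.2
  let x : C.1 ⊕ (PUnit.{u + 1} ⊕ PUnit.{u + 1}) := Sum.inr (Sum.inl PUnit.unit)
  let y : C.1 ⊕ (PUnit.{u + 1} ⊕ PUnit.{u + 1}) := Sum.inr (Sum.inr PUnit.unit)
  refine ⟨PUnit.{u + 1} ⊕ PUnit.{u + 1}, inferInstance, _, _,
    ((sameFormula_conj (.var x) Sum.inl Sum.inl).and
      (sameFormula_conj (.var y) Sum.inl Sum.inl)).and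
      ((((SameTerm.var x).pow K).mul ((SameTerm.var y).pow K)).eq
        (((SameTerm.var y).pow K).mul ((SameTerm.var x).pow K))).not,
    ⟨Sum.elim (fun _ => g) (fun _ => h), fun _ => ⟨⟨(mem_normalizer_iff_of_finite C.1 g).1 hg,
      (mem_normalizer_iff_of_finite C.1 h).1 hh⟩, hgh⟩⟩,
    fun _ f _ e' he' hall => (he' 1).2 (hall (e' (Sum.inl PUnit.unit)) ?_
      (e' (Sum.inr PUnit.unit)) ?_)⟩
  · exact (mem_normalizer_range_iff f _).2 (he' 1).1.1
  · exact (mem_normalizer_range_iff f _).2 (he' 1).1.2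

/-- `C` is itself one of the subgroups joined, so inequality can only mean that some member of the
join is not inside `C`. -/
theorem maxFiniteNormalized_normalizer_ne_iff (C : FiniteSubgroup G) :
    maxFiniteNormalized (Subgroup.normalizer (C.1 : Set G)) ≠ C.1 ↔ ∃ F : Subgroup G, Finite F ∧
      Subgroup.normalizer (C.1 : Set G) ≤ Subgroup.normalizer (F : Set G) ∧ ¬ F ≤ C.1 := by
  constructor
  · intro h
    by_contra! hc
    exact h (le_antisymm (sSup_le fun F hF => hc F hF.1 hF.2) (le_sSup ⟨C.2, le_rfl⟩))
  · rintro ⟨F, hF, hN, hFC⟩ h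
    exact hFC (h ▸ le_sSup ⟨hF, hN⟩)

theorem expresses_maxFiniteNormalized_ne (C : FiniteSubgroup G)
    (h : maxFiniteNormalized (Subgroup.normalizer (C.1 : Set G)) ≠ C.1) :
    Expresses C (fun D : FiniteSubgroup G' =>
      maxFiniteNormalized (Subgroup.normalizer (D.1 : Set G')) ≠ D.1) := by
  obtain ⟨F, hF, hN, hFC⟩ := (maxFiniteNormalized_normalizer_ne_iff C).1 h
  obtain ⟨s, hs, hsC⟩ := SetLike.not_le_iff_exists.1 hFC
  have := C.2
  -- The extra variables list the elements of `F`. Only the multiplication table is imposed, not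
  -- distinctness: a homomorphic image of `F` in `G'` is still finite, and `s` keeps it outside the
  -- copy of `C`.
  refine ⟨F, hF, _, _,
    ((SameFormula.all fun a : F => .all fun b : F => ((SameTerm.var (Sum.inr a)).mul
        (.var (Sum.inr b))).eq (.var (Sum.inr (a * b)))).and
      ((sameFormula_conj .last Sum.inl Sum.inl).imp (sameFormula_conj .last Sum.inr Sum.inr))).and
      (SameFormula.all fun a : C.1 =>
        ((SameTerm.var (Sum.inr ⟨s, hs⟩)).eq (.var (Sum.inl a))).not),
    ⟨fun a => a, fun g => ⟨⟨fun a b => rfl, fun hg => ?_⟩, fun a ha => ?_⟩⟩,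
    fun _ f _ e' he' => (maxFiniteNormalized_normalizer_ne_iff _).2 ?_⟩
  · exact (mem_normalizer_iff_of_finite F g).1 (hN ((mem_normalizer_iff_of_finite C.1 g).2 hg))
  · have h : s = a := ha
    exact hsC (h ▸ a.2)
  · let φ : F →* G' := MonoidHom.mk' e' fun a b => ((he' 1).1.1 a b).symm
    refine ⟨φ.range, inferInstance, fun g hg => ?_, fun hle => ?_⟩
    · exact (mem_normalizer_range_iff φ g).2 ((he' g).1.2 ((mem_normalizer_range_iff f g).1 hg))
    · obtain ⟨a, ha⟩ := hle ⟨⟨s, hs⟩, rfl⟩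
      exact (he' 1).2 a ha.symm

/-- Conjugation by `u α` induces on the image of `f` the transport of `α`, and transport along an
isomorphism is injective. -/
theorem card_autIn_le_range (C : FiniteSubgroup G) [Finite C.1] (f : C.1 →* G')
    (hf : Function.Injective f) (u : autIn C.1 → G')
    (hu : ∀ α : autIn C.1, ∀ a, u α * f a * (u α)⁻¹ = f (α.1 a)) :
    Nat.card (autIn C.1) ≤ Nat.card (autIn (FiniteSubgroup.range f).1) := by
  let e : C.1 ≃* (FiniteSubgroup.range f).1 := MonoidHom.ofInjective hf
  have : Finite (FiniteSubgroup.range f).1 := (FiniteSubgroup.range f).2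
  have : Finite (MulAut (FiniteSubgroup.range f).1) :=
    Finite.of_injective MulEquiv.toEquiv MulEquiv.toEquiv_injective
  refine Nat.card_le_card_of_injective (fun α => (⟨MulAut.congr e α.1, u α, ?_, ?_⟩ :
    autIn (FiniteSubgroup.range f).1)) fun α β h => ?_
  · exact (mem_normalizer_range_iff f _).2 fun a => ⟨_, hu α a⟩
  · intro c
    obtain ⟨a, rfl⟩ := e.surjective c
    change (e (α.1 (e.symm (e a))) : G') = _
    rw [e.symm_apply_apply]
    exact (hu α a).symm
  · exact Subtype.ext ((MulAut.congr e).injective (congrArg Subtype.val h))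

theorem expresses_card_autIn_le (C : FiniteSubgroup G) :
    Expresses C (fun D : FiniteSubgroup G' => Nat.card (autIn C.1) ≤ Nat.card (autIn D.1)) := by
  have := C.2
  have : Finite (MulAut C.1) :=
    Finite.of_injective MulEquiv.toEquiv MulEquiv.toEquiv_injective
  choose w hw using fun α : autIn C.1 => α.2
  refine ⟨autIn C.1, inferInstance, _, _,
    (SameFormula.all fun α : autIn C.1 => .all fun a : C.1 =>
      ((SameTerm.var (Sum.inr α)).conj (.var (Sum.inl a))).eq (.var (Sum.inl (α.1 a)))),
    ⟨w, fun _ α a => ((hw α).2 a).symm⟩, fun _ f hf e' he' => card_autIn_le_range C f hf e' (he' 1)⟩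

theorem cls_eq_iff (C D : FiniteSubgroup G) :
    C.cls = D.cls ↔ ∃ g : G, D.1 = C.1.map (MulAut.conj g).toMonoidHom :=
  ⟨fun h => Quotient.exact (s := finiteSubgroupSetoid G) h,
    fun h => Quotient.sound (s := finiteSubgroupSetoid G) h⟩

theorem card_autIn_le_of_cls_eq {C D : FiniteSubgroup G} (h : C.cls = D.cls) :
    Nat.card (autIn C.1) ≤ Nat.card (autIn D.1) := by
  obtain ⟨g, hg⟩ := (cls_eq_iff C D).1 h
  have := C.2
  choose w hw using fun α : autIn C.1 => α.2
  let f : C.1 →* G := (MulAut.conj g).toMonoidHom.comp C.1.subtype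
  have hD : D = FiniteSubgroup.range f := Subtype.ext (by
    rw [hg]
    ext x
    simp [FiniteSubgroup.range, f])
  rw [hD]
  refine card_autIn_le_range C f ((MulAut.conj g).injective.comp C.1.subtype_injective)
    (fun α => g * w α * g⁻¹) fun α a => ?_
  have := (hw α).2 a
  change g * w α * g⁻¹ * (g * a * g⁻¹) * (g * w α * g⁻¹)⁻¹ = g * (α.1 a) * g⁻¹
  rw [this]
  group

theorem cls_range_eq_iff {A B : Type*} [Group A] [Finite A] [Group B] [Finite B] (f : A →* G)
    (f' : B →* G) : (FiniteSubgroup.range f).cls = (FiniteSubgroup.range f').cls ↔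
      ∃ g : G, (∀ a, ∃ b, g * f a * g⁻¹ = f' b) ∧ ∀ b, ∃ a, g * f a * g⁻¹ = f' b := by
  rw [cls_eq_iff]
  refine exists_congr fun g => ?_
  rw [SetLike.ext'_iff, Set.Subset.antisymm_iff, and_comm]
  refine and_congr ⟨fun h a => ?_, ?_⟩ ⟨fun h b => ?_, ?_⟩
  · obtain ⟨b, hb⟩ := h ⟨f a, ⟨a, rfl⟩, rfl⟩
    exact ⟨b, hb.symm⟩
  · rintro h _ ⟨_, ⟨a, rfl⟩, rfl⟩
    obtain ⟨b, hb⟩ := h a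
    exact ⟨b, hb.symm⟩
  · obtain ⟨_, ⟨a, rfl⟩, ha⟩ := h ⟨b, rfl⟩
    exact ⟨a, ha⟩
  · rintro h _ ⟨b, rfl⟩
    obtain ⟨a, ha⟩ := h b
    exact ⟨f a, ⟨a, rfl⟩, ha⟩

theorem range_subtype (C : FiniteSubgroup G) [Finite C.1] :
    FiniteSubgroup.range C.1.subtype = C :=
  Subtype.ext C.1.range_subtype

/-- A finite family of pairwise non-conjugate finite subgroups of `G` with expressible properties
gives rise to such a family in `G'`. -/
theorem exists_family_of_expresses (hTh : forallExistsTheory G' ⊆ forallExistsTheory G)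
    {ι : Type*} [Finite ι] (C : ι → FiniteSubgroup G) (hC : Function.Injective fun i => (C i).cls)
    (Q' : ι → FiniteSubgroup G' → Prop) (hQ : ∀ i, Expresses (C i) (Q' i)) :
    ∃ D : ι → FiniteSubgroup G', (Function.Injective fun i => (D i).cls) ∧ ∀ i, Q' i (D i) := by
  have hfin : ∀ i, Finite (C i).1 := fun i => (C i).2
  choose ε hε P P' hP he hQ using hQ
  choose e he using he
  let V := Σ i, ((C i).1 ⊕ ε i)
  let v : (i : ι) → (C i).1 → V := fun i a => ⟨i, Sum.inl a⟩
  -- For each `i`: the multiplication table of `C i`, distinctness of its elements and its own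
  -- condition; for `i ≠ j`: the universally quantified element does not conjugate the `i`-th family
  -- onto the `j`-th.
  have hS := ((SameFormula.all fun i => (SameFormula.all fun a : (C i).1 => .all fun b =>
      ((SameTerm.var (G := G) (G' := G') (v i a)).mul (.var (v i b))).eq (.var (v i (a * b)))).and
      ((SameFormula.all fun a : (C i).1 => .all fun b : (C i).1 => (SameFormula.const (a ≠ b)).imp
        ((SameTerm.var (v i a)).eq (.var (v i b))).not).and
      ((hP i).relabel (fun c => (⟨i, c⟩ : V))))).and
    (SameFormula.all fun i => SameFormula.all fun j => (SameFormula.const (i ≠ j)).imp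
      ((sameFormula_conj .last (v i) (v j)).and
        (.all fun b => .ex fun a => (SameTerm.last.conj (.var (v i a))).eq (.var (v j b)))).not))
  obtain ⟨x, hx⟩ := hS.exists_forall hTh (by
    refine ⟨fun w => Sum.elim (fun a : (C w.1).1 => (a : G)) (e w.1) w.2,
      fun g => ⟨fun i => ⟨fun a b => rfl, fun a b hab h => hab (Subtype.ext h), ?_⟩,
        fun i j hij h => hij (hC ?_)⟩⟩
    · exact he i g
    · have := (cls_range_eq_iff (C i).1.subtype (C j).1.subtype).2 ⟨g, h⟩
      rwa [range_subtype, range_subtype] at this)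
  let f : (i : ι) → (C i).1 →* G' := fun i =>
    MonoidHom.mk' (fun a => x (v i a)) fun a b => (((hx 1).1 i).1 a b).symm
  have hf : ∀ i, Function.Injective (f i) := by
    intro i a b hab
    by_contra hne
    exact ((hx 1).1 i).2.1 a b hne hab
  refine ⟨fun i => FiniteSubgroup.range (f i), fun i j hij => ?_, fun i => ?_⟩
  · by_contra hne
    obtain ⟨g, hg⟩ := (cls_range_eq_iff (f i) (f j)).1 hij
    exact (hx g).2 i j hne hg
  · refine hQ i (hfin i) (f i) (hf i) (fun z => x ⟨i, Sum.inr z⟩) fun g => ?_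
    convert ((hx g).1 i).2.2 using 2 with c
    cases c <;> rfl

end Expresses

/-! ### Comparison of the five numbers -/

section Comparison

variable {G : Type u} {G' : Type v} [Group G] [Group G']

theorem rep_cls (c : FiniteSubgroupClass G) : c.rep.cls = c :=
  Quotient.out_eq (s := finiteSubgroupSetoid G) c

theorem ncard_classes_le [Finite (FiniteSubgroupClass G)] [Finite (FiniteSubgroupClass G')]
    (hTh : forallExistsTheory G' ⊆ forallExistsTheory G) {Q : FiniteSubgroup G → Prop}
    {Q' : FiniteSubgroup G' → Prop} (hQ : ∀ C, Q C → Expresses C Q') :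
    Set.ncard {c : FiniteSubgroupClass G | ∃ C : FiniteSubgroup G, C.cls = c ∧ Q C} ≤
      Set.ncard {c : FiniteSubgroupClass G' | ∃ C : FiniteSubgroup G', C.cls = c ∧ Q' C} := by
  choose C hC hQC using
    fun c : {c : FiniteSubgroupClass G | ∃ C : FiniteSubgroup G, C.cls = c ∧ Q C} => c.2
  obtain ⟨D, hD, hQD⟩ := exists_family_of_expresses hTh C
    (fun c c' h => Subtype.ext (by rw [← hC c, ← hC c']; exact h)) (fun _ => Q')
    fun c => hQ _ (hQC c)
  rw [← Nat.card_coe_set_eq, ← Nat.card_coe_set_eq]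
  exact Nat.card_le_card_of_injective
    (fun c => (⟨(D c).cls, D c, rfl, hQD c⟩ :
      {c : FiniteSubgroupClass G' | ∃ C : FiniteSubgroup G', C.cls = c ∧ Q' C}))
    fun c c' h => hD (congrArg Subtype.val h)

theorem n₁_le [Finite (FiniteSubgroupClass G)] [Finite (FiniteSubgroupClass G')]
    (hTh : forallExistsTheory G' ⊆ forallExistsTheory G) : n₁ G ≤ n₁ G' := by
  obtain ⟨D, hD, -⟩ := exists_family_of_expresses hTh (fun c : FiniteSubgroupClass G => c.rep)
    (fun c c' h => by rw [← rep_cls c, ← rep_cls c']; exact h)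
    (fun _ _ => True) (fun c => expresses_true _)
  exact Nat.card_le_card_of_injective _ hD

theorem n₂_le [Finite (FiniteSubgroupClass G)] [Finite (FiniteSubgroupClass G')]
    (hTh : forallExistsTheory G' ⊆ forallExistsTheory G) : n₂ G ≤ n₂ G' := by
  obtain ⟨D, hD, hcard⟩ := exists_family_of_expresses hTh (fun c : FiniteSubgroupClass G => c.rep)
    (fun c c' h => by rw [← rep_cls c, ← rep_cls c']; exact h)
    _ (fun c => expresses_card_autIn_le _)
  have := Fintype.ofFinite (FiniteSubgroupClass G)
  have := Fintype.ofFinite (FiniteSubgroupClass G')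
  rw [n₂, n₂, finsum_eq_sum_of_fintype, finsum_eq_sum_of_fintype]
  calc ∑ c : FiniteSubgroupClass G, Nat.card (autIn c.rep.1)
      ≤ ∑ c : FiniteSubgroupClass G, Nat.card (autIn (D c).cls.rep.1) :=
        Finset.sum_le_sum fun c _ => (hcard c).trans (card_autIn_le_of_cls_eq (rep_cls _).symm)
    _ = ∑ c ∈ Finset.univ.map ⟨fun c => (D c).cls, hD⟩, Nat.card (autIn c.rep.1) := by
        rw [Finset.sum_map]; rfl
    _ ≤ ∑ c : FiniteSubgroupClass G', Nat.card (autIn c.rep.1) :=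
        Finset.sum_le_sum_of_subset (Finset.subset_univ _)

theorem n₄_le (hG : IsHyperbolicGroup G) (hG' : IsHyperbolicGroup G')
    (hTh : forallExistsTheory G' ⊆ forallExistsTheory G) : n₄ G ≤ n₄ G' := by
  have := hG.finite_finiteSubgroupClass
  have := hG'.finite_finiteSubgroupClass
  obtain ⟨B, hB⟩ := hG.exists_torsionBounded
  obtain ⟨B', hB'⟩ := hG'.exists_torsionBounded
  -- The exponent appears literally in the formula, so one bound must serve both groups.
  have hB := hB.mono (le_max_left B B')
  have hB' := hB'.mono (le_max_right B B')
  refine ncard_classes_le hTh fun C hC => ?_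
  simp only [hG.isVirtuallyCyclic_iff hB] at hC
  simp only [hG'.isVirtuallyCyclic_iff hB']
  exact expresses_exists_not_commute C _ hC

theorem n₅_le (hG : IsHyperbolicGroup G) (hG' : IsHyperbolicGroup G')
    (hTh : forallExistsTheory G' ⊆ forallExistsTheory G) : n₅ G ≤ n₅ G' := by
  have := hG.finite_finiteSubgroupClass
  have := hG'.finite_finiteSubgroupClass
  obtain ⟨B, hB⟩ := hG.exists_torsionBounded
  obtain ⟨B', hB'⟩ := hG'.exists_torsionBounded
  have hB := hB.mono (le_max_left B B')
  have hB' := hB'.mono (le_max_right B B')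
  refine ncard_classes_le hTh fun C hC => ?_
  simp only [hG.isVirtuallyCyclic_iff hB] at hC
  simp only [hG'.isVirtuallyCyclic_iff hB']
  exact (expresses_exists_not_commute C _ hC.1).and (expresses_maxFiniteNormalized_ne C hC.2)

theorem ncard_infinite_normalizer_le (hG : IsHyperbolicGroup G) (hG' : IsHyperbolicGroup G')
    (hTh : forallExistsTheory G' ⊆ forallExistsTheory G) :
    Set.ncard {c : FiniteSubgroupClass G | ∃ C : FiniteSubgroup G, C.cls = c ∧
      Infinite (Subgroup.normalizer (C.1 : Set G))} ≤
    Set.ncard {c : FiniteSubgroupClass G' | ∃ C : FiniteSubgroup G', C.cls = c ∧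
      Infinite (Subgroup.normalizer (C.1 : Set G'))} := by
  have := hG.finite_finiteSubgroupClass
  have := hG'.finite_finiteSubgroupClass
  obtain ⟨B, hB⟩ := hG.exists_torsionBounded
  obtain ⟨B', hB'⟩ := hG'.exists_torsionBounded
  have hB := hB.mono (le_max_left B B')
  have hB' := hB'.mono (le_max_right B B')
  refine ncard_classes_le hTh fun C hC => ?_
  rw [hB.infinite_iff] at hC
  simp only [hB'.infinite_iff]
  exact expresses_exists_pow_ne_one C _ hC

theorem isVirtuallyCyclic_of_finite [Finite G] : IsVirtuallyCyclic G :=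
  ⟨⊥, inferInstance, inferInstance⟩

theorem IsVirtuallyCyclic.of_mulEquiv {A B : Type*} [Group A] [Group B] (e : A ≃* B)
    (h : IsVirtuallyCyclic A) : IsVirtuallyCyclic B := by
  obtain ⟨H, hH, hfin⟩ := h
  refine ⟨H.map e.toMonoidHom, ?_, ⟨?_⟩⟩
  · exact isCyclic_of_surjective (e.subgroupMap H) (e.subgroupMap H).surjective
  · have : (H.map e.toMonoidHom).index = H.index := Subgroup.index_map_equiv H e
    rw [this]
    exact hfin.index_ne_zero

theorem nonempty_normalizer_mulEquiv {C D : FiniteSubgroup G} (h : C.cls = D.cls) :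
    Nonempty (Subgroup.normalizer (C.1 : Set G) ≃* Subgroup.normalizer (D.1 : Set G)) := by
  obtain ⟨g, hg⟩ := (cls_eq_iff C D).1 h
  have e : (Subgroup.normalizer (C.1 : Set G)).map (MulAut.conj g).toMonoidHom =
      Subgroup.normalizer (D.1 : Set G) := by
    rw [hg]
    exact Subgroup.map_equiv_normalizer_eq C.1 (MulAut.conj g)
  exact ⟨((MulAut.conj g).subgroupMap _).trans (MulEquiv.subgroupCongr e)⟩

/-- Subtraction avoids expressing virtual cyclicity itself, a universal condition on two elements.
The two sets of classes are disjoint because conjugate subgroups have isomorphic normalizers. -/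
theorem n₃_add_n₄ [Finite (FiniteSubgroupClass G)] :
    n₃ G + n₄ G = Set.ncard {c : FiniteSubgroupClass G | ∃ C : FiniteSubgroup G, C.cls = c ∧
      Infinite (Subgroup.normalizer (C.1 : Set G))} := by
  rw [n₃, n₄, ← Set.ncard_union_eq]
  · congr 1
    ext c
    constructor
    · rintro (⟨C, hc, h, -⟩ | ⟨C, hc, h⟩)
      · exact ⟨C, hc, h⟩
      · exact ⟨C, hc, not_finite_iff_infinite.1 fun _ => h isVirtuallyCyclic_of_finite⟩
    · rintro ⟨C, hc, h⟩
      by_cases hv : IsVirtuallyCyclic (Subgroup.normalizer (C.1 : Set G))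
      · exact Or.inl ⟨C, hc, h, hv⟩
      · exact Or.inr ⟨C, hc, hv⟩
  · rw [Set.disjoint_left]
    rintro c ⟨C, hc, -, h⟩ ⟨D, hd, h'⟩
    obtain ⟨e⟩ := nonempty_normalizer_mulEquiv (hc.trans hd.symm)
    exact h' (h.of_mulEquiv e)

end Comparison

end GroupInvariants

/-- The finiteness clauses say that the five numbers are genuine (finite) counts. -/
theorem mainTheorem8 {G : Type*} [Group G] {G' : Type*} [Group G']
    (hG : GroupInvariants.IsHyperbolicGroup G) (hG' : GroupInvariants.IsHyperbolicGroup G')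
    (hTh : GroupInvariants.forallExistsTheory G = GroupInvariants.forallExistsTheory G') :
    Finite (GroupInvariants.FiniteSubgroupClass G) ∧
    Finite (GroupInvariants.FiniteSubgroupClass G') ∧
    GroupInvariants.n₁ G = GroupInvariants.n₁ G' ∧
    GroupInvariants.n₂ G = GroupInvariants.n₂ G' ∧
    GroupInvariants.n₃ G = GroupInvariants.n₃ G' ∧
    GroupInvariants.n₄ G = GroupInvariants.n₄ G' ∧
    GroupInvariants.n₅ G = GroupInvariants.n₅ G' := by
  open GroupInvariants in
  have h := hG.finite_finiteSubgroupClass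
  have h' := hG'.finite_finiteSubgroupClass
  have h₄ : n₄ G = n₄ G' := le_antisymm (n₄_le hG hG' hTh.ge) (n₄_le hG' hG hTh.le)
  have hinf := le_antisymm (ncard_infinite_normalizer_le hG hG' hTh.ge)
    (ncard_infinite_normalizer_le hG' hG hTh.le)
  rw [← n₃_add_n₄, ← n₃_add_n₄] at hinf
  exact ⟨h, h', le_antisymm (n₁_le hTh.ge) (n₁_le hTh.le),
    le_antisymm (n₂_le hTh.ge) (n₂_le hTh.le), by omega, h₄,
    le_antisymm (n₅_le hG hG' hTh.ge) (n₅_le hG' hG hTh.le)⟩
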